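/- Let $T>0$ and let $\Omega\subset\mathbb R^2$ be bounded, convex and open. Let $H^3_0(\Omega)^2$ be the closure of $C_c^\infty(\Omega)^2$ in $H^3(\Omega)^2$, and let $H^{3,\mathrm{div}}_0(\Omega)^2=\{f\in H^3_0(\Omega)^2 : \mathrm{div} f=0\}$. For $u_0\in L^1(\Omega)$ and $b\in L^2([0,T];H^{3,\mathrm{div}}_0(\Omega)^2)$, a function $u\in L^2([0,T];L^1(\Omega))$ is called a weak solution of the transport equation $\partial_t u+b\cdot\nabla u=0$, $u(0,\cdot)=u_0$, if $$\int_0^T\!\!\int_\Omega u\,(\partial_t\varphi+b\cdot\nabla\varphi)\,dx\,dt=-\int_\Omega u_0(x)\,\varphi(0,x)\,dx\qquad\text{for all }\varphi\in C_c^\infty([0,T[\times\Omega).$$ We write $u=G(u_0,b)$ if $u$ is a weak solution and it is the only one in $L^2([0,T];L^1(\Omega))$. **Theorem (weak sequential closeness).** Let $u_0\in L^1(\Omega)$, and let $(b_n)$ be a sequence in $L^2([0,T];H^{3,\mathrm{div}}_0(\Omega)^2)$ that is bounded and converges weakly to $b$ in $L^2([0,T];H^3(\Omega)^2)$. Let $u_n\in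 L^2([0,T];L^1(\Omega))$ be weak solutions of the transport equation with flow field $b_n$ and initial value $u_0$. Suppose that $u_n\to\hat u$ in $L^2([0,T];L^1(\Omega))$ and that $\hat u\in L^2([0,T];L^2(\Omega))$. Then $b\in L^2([0,T];H^{3,\mathrm{div}}_0(\Omega)^2)$ and $\hat u=G(u_0,b)$; that is, $\hat u$ is a weak solution of the transport equation with flow field $b$ and initial value $u_0$, and it is the only one in $L^2([0,T];L^1(\Omega))$. -/

import Mathlib

open MeasureTheory Filter Topology Set
open scoped ContDiff ENNReal

noncomputable section

/-- The Euclidean plane `ℝ²`. -/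
abbrev Plane : Type := EuclideanSpace ℝ (Fin 2)

/-- Lebesgue measure on `Ω ⊆ ℝ²`. -/
abbrev spaceMeasure (Ω : Set Plane) : Measure Plane := volume.restrict Ω

/-- Lebesgue measure on `[0,T]`. -/
abbrev timeMeasure (T : ℝ) : Measure ℝ := volume.restrict (Icc 0 T)

/-- The multi-indices `α = (α₁, α₂)` with `|α| ≤ 3`. -/
abbrev MultiIdx : Type := {α : Fin 4 × Fin 4 // (α.1 : ℕ) + (α.2 : ℕ) ≤ 3}

/-- The order `|α|`. -/
def MultiIdx.order (α : MultiIdx) : ℕ := (α.1.1 : ℕ) + (α.1.2 : ℕ)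

/-- The multi-index of order `0`. -/
def MultiIdx.zero : MultiIdx := ⟨(0, 0), by decide⟩

/-- The multi-index of `∂₁`. -/
def MultiIdx.e₁ : MultiIdx := ⟨(1, 0), by decide⟩

/-- The multi-index of `∂₂`. -/
def MultiIdx.e₂ : MultiIdx := ⟨(0, 1), by decide⟩

/-- The classical partial derivative `∂ᵢ f`. -/
def partialD {F : Type*} [NormedAddCommGroup F] [NormedSpace ℝ F] (i : Fin 2)
    (f : Plane → F) : Plane → F :=
  fun x => fderiv ℝ f x (EuclideanSpace.single i 1)

/-- The classical derivative `∂^α f = ∂₁^{α₁} ∂₂^{α₂} f`. -/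
def multiD {F : Type*} [NormedAddCommGroup F] [NormedSpace ℝ F] (α : MultiIdx)
    (f : Plane → F) : Plane → F :=
  (partialD 0)^[(α.1.1 : ℕ)] ((partialD 1)^[(α.1.2 : ℕ)] f)

/-- `f ∈ C_c^∞(Ω; F)`. -/
def IsTestFun {F : Type*} [NormedAddCommGroup F] [NormedSpace ℝ F] (Ω : Set Plane)
    (f : Plane → F) : Prop :=
  ContDiff ℝ ∞ f ∧ HasCompactSupport f ∧ tsupport f ⊆ Ω

/-- `g` is the weak derivative `∂^α f` on `Ω`. -/
def HasWeakD (Ω : Set Plane) (α : MultiIdx) (f g : Plane → Plane) : Prop :=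
  ∀ φ : Plane → ℝ, IsTestFun Ω φ →
    ∫ x in Ω, multiD α φ x • f x = (-1 : ℝ) ^ α.order • ∫ x in Ω, φ x • g x

/-- Families `(F_α)_{|α| ≤ 3}` in `L²(Ω)²`, with the norm `(∑_α ‖F_α‖²_{L²})^{1/2}`. -/
abbrev JetSpace (Ω : Set Plane) : Type :=
  PiLp 2 (fun _ : MultiIdx => Lp Plane 2 (spaceMeasure Ω))

lemma ContDiff.partialD {F : Type*} [NormedAddCommGroup F] [NormedSpace ℝ F] (i : Fin 2)
    {f : Plane → F} (hf : ContDiff ℝ ∞ f) : ContDiff ℝ ∞ (_root_.partialD i f) :=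
  (hf.fderiv_right (m := ∞) (by simp)).clm_apply contDiff_const

lemma HasCompactSupport.partialD {F : Type*} [NormedAddCommGroup F] [NormedSpace ℝ F]
    (i : Fin 2) {f : Plane → F} (hf : HasCompactSupport f) :
    HasCompactSupport (_root_.partialD i f) :=
  hf.fderiv_apply (𝕜 := ℝ) _

lemma multiD_contDiff_compact {F : Type*} [NormedAddCommGroup F] [NormedSpace ℝ F]
    (α : MultiIdx) {f : Plane → F} (hf : ContDiff ℝ ∞ f) (hc : HasCompactSupport f) :
    ContDiff ℝ ∞ (multiD α f) ∧ HasCompactSupport (multiD α f) := by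
  have key : ∀ (i : Fin 2) (k : ℕ) (g : Plane → F), ContDiff ℝ ∞ g ∧ HasCompactSupport g →
      ContDiff ℝ ∞ ((partialD i)^[k] g) ∧ HasCompactSupport ((partialD i)^[k] g) := by
    intro i k
    induction k with
    | zero => intro g hg; exact hg
    | succ k ih => intro g hg; exact ih _ ⟨hg.1.partialD i, hg.2.partialD i⟩
  exact key 0 _ _ (key 1 _ _ ⟨hf, hc⟩)

lemma integrable_smul_of_test {Ω : Set Plane} {φ : Plane → ℝ} (hφ : ContDiff ℝ ∞ φ)
    (hc : HasCompactSupport φ) (f : Lp Plane 2 (spaceMeasure Ω)) :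
    Integrable (fun x => φ x • f x) (spaceMeasure Ω) := by
  have h1 : MemLp φ 2 (spaceMeasure Ω) :=
    (hφ.continuous.memLp_of_hasCompactSupport hc)
  exact memLp_one_iff_integrable.1 ((Lp.memLp f).smul h1)

/-- The Sobolev space `H³(Ω)²`: a function `f ∈ L²(Ω)²` with weak derivatives
`∂^α f ∈ L²(Ω)²` for all `|α| ≤ 3` is represented by the family `(∂^α f)_{|α| ≤ 3}`, so that the
norm is `(∑_{|α| ≤ 3} ‖∂^α f‖²_{L²})^{1/2}`. -/
def H3 (Ω : Set Plane) : Submodule ℝ (JetSpace Ω) where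
  carrier := {F | ∀ α : MultiIdx, HasWeakD Ω α (F MultiIdx.zero) (F α)}
  zero_mem' := by
    intro α φ _
    have h : ((0 : JetSpace Ω) MultiIdx.zero : Plane → Plane) =ᵐ[spaceMeasure Ω] 0 :=
      Lp.coeFn_zero _ _ _
    have h' : ((0 : JetSpace Ω) α : Plane → Plane) =ᵐ[spaceMeasure Ω] 0 :=
      Lp.coeFn_zero _ _ _
    have e1 : ∫ x in Ω, multiD α φ x • ((0 : JetSpace Ω) MultiIdx.zero) x = 0 := by
      rw [integral_eq_zero_of_ae]
      filter_upwards [h] with x hx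
      rw [hx, Pi.zero_apply, smul_zero]
    have e2 : ∫ x in Ω, φ x • ((0 : JetSpace Ω) α) x = 0 := by
      rw [integral_eq_zero_of_ae]
      filter_upwards [h'] with x hx
      rw [hx, Pi.zero_apply, smul_zero]
    rw [e1, e2, smul_zero]
  add_mem' := by
    intro F G hF hG α φ hφ
    have hD := multiD_contDiff_compact α hφ.1 hφ.2.1
    have e1 : ∫ x in Ω, multiD α φ x • ((F + G) MultiIdx.zero) x
        = (∫ x in Ω, multiD α φ x • (F MultiIdx.zero) x)
          + ∫ x in Ω, multiD α φ x • (G MultiIdx.zero) x := by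
      rw [← integral_add (integrable_smul_of_test hD.1 hD.2 _)
        (integrable_smul_of_test hD.1 hD.2 _)]
      refine integral_congr_ae ?_
      filter_upwards [Lp.coeFn_add (F MultiIdx.zero) (G MultiIdx.zero)] with x hx
      rw [PiLp.add_apply, hx, Pi.add_apply, smul_add]
    have e2 : ∫ x in Ω, φ x • ((F + G) α) x
        = (∫ x in Ω, φ x • (F α) x) + ∫ x in Ω, φ x • (G α) x := by
      rw [← integral_add (integrable_smul_of_test hφ.1 hφ.2.1 _)
        (integrable_smul_of_test hφ.1 hφ.2.1 _)]
      refine integral_congr_ae ?_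
      filter_upwards [Lp.coeFn_add (F α) (G α)] with x hx
      rw [PiLp.add_apply, hx, Pi.add_apply, smul_add]
    rw [e1, e2, smul_add, hF α φ hφ, hG α φ hφ]
  smul_mem' := by
    intro c F hF α φ hφ
    have e1 : ∫ x in Ω, multiD α φ x • ((c • F) MultiIdx.zero) x
        = c • ∫ x in Ω, multiD α φ x • (F MultiIdx.zero) x := by
      rw [← integral_smul]
      refine integral_congr_ae ?_
      filter_upwards [Lp.coeFn_smul c (F MultiIdx.zero)] with x hx
      rw [PiLp.smul_apply, hx, Pi.smul_apply, smul_comm]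
    have e2 : ∫ x in Ω, φ x • ((c • F) α) x = c • ∫ x in Ω, φ x • (F α) x := by
      rw [← integral_smul]
      refine integral_congr_ae ?_
      filter_upwards [Lp.coeFn_smul c (F α)] with x hx
      rw [PiLp.smul_apply, hx, Pi.smul_apply, smul_comm]
    rw [e1, e2, hF α φ hφ, smul_comm]

/-- The weak derivative `∂^α f ∈ L²(Ω)²` of `f ∈ H³(Ω)²`. -/
def H3.D {Ω : Set Plane} (α : MultiIdx) (f : H3 Ω) : Lp Plane 2 (spaceMeasure Ω) :=
  (f : JetSpace Ω) α

/-- The underlying function of `f ∈ H³(Ω)²`. -/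
def H3.val {Ω : Set Plane} (f : H3 Ω) : Lp Plane 2 (spaceMeasure Ω) :=
  H3.D MultiIdx.zero f

/-- `H³₀(Ω)²`, the closure of `C_c^∞(Ω)²` in `H³(Ω)²`. -/
def H30 (Ω : Set Plane) : Set (H3 Ω) :=
  closure {f | ∃ g : Plane → Plane, IsTestFun Ω g ∧ ∀ α, H3.D α f =ᵐ[spaceMeasure Ω] multiD α g}

/-- `H^{3,div}₀(Ω)²`, the divergence-free fields in `H³₀(Ω)²`. -/
def H30div (Ω : Set Plane) : Set (H3 Ω) :=
  {f | f ∈ H30 Ω ∧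
    ∀ᵐ x ∂(spaceMeasure Ω), H3.D MultiIdx.e₁ f x 0 + H3.D MultiIdx.e₂ f x 1 = 0}

/-- The Bochner space `L²([0,T]; H³(Ω)²)`. -/
abbrev L2H3 (T : ℝ) (Ω : Set Plane) : Type := Lp (H3 Ω) 2 (timeMeasure T)

/-- `b ∈ L²([0,T]; H^{3,div}₀(Ω)²)`. -/
def MemL2H30div {T : ℝ} {Ω : Set Plane} (b : L2H3 T Ω) : Prop :=
  ∀ᵐ t ∂(timeMeasure T), b t ∈ H30div Ω

/-- The Bochner space `L²([0,T]; L¹(Ω))`. -/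
abbrev L2L1 (T : ℝ) (Ω : Set Plane) : Type := Lp (Lp ℝ 1 (spaceMeasure Ω)) 2 (timeMeasure T)

/-- The Bochner space `L²([0,T]; L²(Ω))`. -/
abbrev L2L2 (T : ℝ) (Ω : Set Plane) : Type := Lp (Lp ℝ 2 (spaceMeasure Ω)) 2 (timeMeasure T)

/-- `u ∈ L²([0,T]; L²(Ω))`. -/
def MemL2L2 {T : ℝ} {Ω : Set Plane} (u : L2L1 T Ω) : Prop :=
  ∃ w : L2L2 T Ω, ∀ᵐ t ∂(timeMeasure T), u t =ᵐ[spaceMeasure Ω] w t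

/-- Weak convergence `y n ⇀ z` in a real normed space. -/
def WeaklyConverges {X : Type*} [NormedAddCommGroup X] [NormedSpace ℝ X] (y : ℕ → X) (z : X) :
    Prop :=
  ∀ l : X →L[ℝ] ℝ, Tendsto (fun n => l (y n)) atTop (𝓝 (l z))

/-- `φ ∈ C_c^∞([0,T[ × Ω)`: the restriction to `t ≥ 0` of a smooth function on `ℝ × ℝ²` with compact
support in `]-∞,T[ × Ω`. -/
def IsSpaceTimeTest (T : ℝ) (Ω : Set Plane) (φ : ℝ × Plane → ℝ) : Prop :=
  ContDiff ℝ ∞ φ ∧ HasCompactSupport φ ∧ tsupport φ ⊆ Iio T ×ˢ Ω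

/-- `u` is a weak solution of `∂ₜu + b·∇u = 0` in `]0,T] × Ω`, `u(0) = u₀`: for all
`φ ∈ C_c^∞([0,T[ × Ω)`,
`∫₀ᵀ∫_Ω u (∂ₜφ + b·∇φ) dx dt = - ∫_Ω u₀ φ(0,·) dx`. -/
def IsWeakSolution {T : ℝ} {Ω : Set Plane} (u₀ : Lp ℝ 1 (spaceMeasure Ω)) (b : L2H3 T Ω)
    (u : L2L1 T Ω) : Prop :=
  ∀ φ : ℝ × Plane → ℝ, IsSpaceTimeTest T Ω φ →
    ∫ t in Icc 0 T, ∫ x in Ω,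
        u t x * (fderiv ℝ φ (t, x) (1, 0) + fderiv ℝ φ (t, x) (0, H3.val (b t) x))
      = - ∫ x in Ω, u₀ x * φ (0, x)

/-- `u = G(u₀, b)`, where `G` is the solution operator of the transport equation, defined on fields
`b ∈ L²([0,T]; H^{3,div}₀(Ω)²)`: `u` is the one and only weak solution. -/
def IsSolutionOperatorValue {T : ℝ} {Ω : Set Plane} (u₀ : Lp ℝ 1 (spaceMeasure Ω))
    (b : L2H3 T Ω) (u : L2L1 T Ω) : Prop :=
  MemL2H30div b ∧ IsWeakSolution u₀ b u ∧ ∀ v : L2L1 T Ω, IsWeakSolution u₀ b v → v = u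

end

/-!
The limit `b` has values in `H^{3,div}₀(Ω)²` because this is a closed subspace of `H³(Ω)²`: the
fields in `L²(H³)` with values in it form the kernel of the map induced by the quotient map, and
kernels of continuous linear maps are weakly closed (`ae_mem_of_weaklyConverges`).

The estimate behind everything else is the embedding `H³₀(Ω)² ⊂ W^{1,∞}`. In the plane a compactly
supported function is bounded by the `L¹` norm of `∂₁∂₂f` (`enorm_le_lintegral_mixed`), so `g` and
its first derivatives are bounded by `|Ω|^{1/2} ‖g‖_{H³}`. In particular `b·∇φ` lies in `L²(L^∞)`,
with norm bounded by that of `b`, and pairs with `L²(L¹)`.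

Passage to the limit (`IsWeakSolution.of_tendsto`): in `∫∫ uₙ bₙ·∇φ` the factor `uₙ` may be
replaced by its limit `u`, since `bₙ·∇φ` is bounded in `L²(L^∞)`; then `b ↦ ∫∫ u b·∇φ` is a
continuous functional on `L²(H³)` because `u ∈ L²(L²)`.

Uniqueness (`IsWeakSolution.eq_zero`) is proved by duality. Let `v` be a weak solution with zero
initial value, `ζ` a test function in `x`, and `τ` a time. An exact solution `φ` of the backward
equation `∂ₜφ + b·∇φ = 0`, `φ(τ) = ζ`, as a test function would give `∫ v(τ) ζ = 0`. An approximate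
one suffices, provided that its gradient is bounded uniformly, for the error made by replacing `b`
with a regular field `β` is `∫ ‖v‖ ‖∇φ‖ ‖b - β‖_∞`. No flow of an ordinary differential equation is
used. Instead, `b` is approximated in `L²(H³₀)` by a sum `β` of consecutive pulses `θⱼ(t) gⱼ(x)`
with test fields `gⱼ` (`exists_pulse_approx`), and `φ` is `ζ` composed with the explicit Euler maps
`x ↦ x + Θⱼ(t) gⱼ(x)`, where `Θⱼ` is the backward primitive of `θⱼ` (`ApproxBackward.step`). Each
step multiplies the gradient bound by at most `1 + ‖Θⱼ‖_∞ Lip gⱼ`, and the product of these factors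
is at most `exp (C ∫ ‖β‖_{H³})`. The residual is small when the pulses are short.

The resulting bound for the moment `t ↦ ∫ v(t) ζ`, averaged by a bump in time, is the integral of a
fixed integrable function over the support of the bump (`exists_abs_integral_moment_le`). Lebesgue
differentiation shows that the moment vanishes at almost every time, and a countable dense set of
test functions `ζ` then gives `v = 0`.
-/

/-! ### Sobolev embedding for compactly supported fields in the plane -/

lemma hasDerivAt_comp_line {F : Type*} [NormedAddCommGroup F] [NormedSpace ℝ F]
    {f : Plane → F} (hf : ContDiff ℝ ∞ f) (a : Plane) (i : Fin 2) (r : ℝ) :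
    HasDerivAt (fun r : ℝ => f (a + r • EuclideanSpace.single i (1 : ℝ)))
      (partialD i f (a + r • EuclideanSpace.single i (1 : ℝ))) r := by
  have h1 : HasDerivAt (fun r : ℝ => a + r • (EuclideanSpace.single i (1 : ℝ) : Plane))
      (EuclideanSpace.single i (1 : ℝ) : Plane) r := by
    simpa using ((hasDerivAt_id r).smul_const (EuclideanSpace.single i (1 : ℝ) : Plane)).const_add a
  exact ((hf.differentiable (by simp)) _).hasFDerivAt.comp_hasDerivAt r h1

lemma isClosedEmbedding_line (a : Plane) (i : Fin 2) :
    IsClosedEmbedding (fun r : ℝ => a + r • (EuclideanSpace.single i (1 : ℝ) : Plane)) := by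
  apply Isometry.isClosedEmbedding
  refine Isometry.of_dist_eq fun r s => ?_
  rw [dist_add_left, dist_eq_norm, ← sub_smul, norm_smul]
  simp [Real.dist_eq]

/-- The fundamental theorem of calculus along a coordinate line. -/
lemma enorm_le_lintegral_partialD {F : Type*} [NormedAddCommGroup F] [NormedSpace ℝ F]
    {f : Plane → F} (hf : ContDiff ℝ ∞ f) (hc : HasCompactSupport f) (i : Fin 2)
    (a : Plane) (r : ℝ) :
    ‖f (a + r • EuclideanSpace.single i (1 : ℝ))‖ₑ
      ≤ ∫⁻ s : ℝ, ‖partialD i f (a + s • EuclideanSpace.single i (1 : ℝ))‖ₑ := by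
  have h1 : ContDiff ℝ 1 (fun r : ℝ => f (a + r • (EuclideanSpace.single i (1 : ℝ) : Plane))) :=
    (hf.of_le (by exact_mod_cast le_top)).comp (by fun_prop)
  have h2 : HasCompactSupport
      (fun r : ℝ => f (a + r • (EuclideanSpace.single i (1 : ℝ) : Plane))) :=
    hc.comp_isClosedEmbedding (isClosedEmbedding_line a i)
  refine (h2.enorm_le_lintegral_Ici_deriv h1 r).trans ?_
  simp_rw [fun s => (hasDerivAt_comp_line hf a i s).deriv]
  exact lintegral_mono' Measure.restrict_le_self le_rfl

lemma lintegral_plane_eq (f : Plane → ℝ≥0∞) (hf : Measurable f) :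
    ∫⁻ x, f x = ∫⁻ r : ℝ, ∫⁻ s : ℝ,
      f (r • EuclideanSpace.single 1 (1 : ℝ) + s • EuclideanSpace.single 0 (1 : ℝ)) := by
  have e1 : ∫⁻ x, f x = ∫⁻ y : Fin 2 → ℝ, f (WithLp.toLp 2 y) :=
    ((PiLp.volume_preserving_toLp (Fin 2)).lintegral_comp hf).symm
  have e2 : ∫⁻ y : Fin 2 → ℝ, f (WithLp.toLp 2 y)
      = ∫⁻ z : ℝ × ℝ, f (WithLp.toLp 2 (MeasurableEquiv.finTwoArrow.symm z)) :=
    (((volume_preserving_finTwoArrow ℝ).symm _).lintegral_comp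
      (hf.comp (PiLp.volume_preserving_toLp (Fin 2)).measurable)).symm
  rw [e1, e2, Measure.volume_eq_prod, lintegral_prod_symm']
  · congr 1; ext r; congr 1; ext s; congr 1
    ext i
    fin_cases i <;> simp [MeasurableEquiv.finTwoArrow]
  · exact (hf.comp (PiLp.volume_preserving_toLp (Fin 2)).measurable).comp
      (MeasurableEquiv.measurable _)

lemma plane_eq_add_smul (x : Plane) :
    x = x 1 • EuclideanSpace.single 1 (1 : ℝ) + x 0 • EuclideanSpace.single 0 (1 : ℝ) := by
  ext i; fin_cases i <;> simp

/-- A compactly supported function in the plane is bounded by the `L¹` norm of its mixed second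
derivative: integrate first along the second, then along the first coordinate direction. -/
lemma enorm_le_lintegral_mixed {F : Type*} [NormedAddCommGroup F] [NormedSpace ℝ F]
    {f : Plane → F} (hf : ContDiff ℝ ∞ f) (hc : HasCompactSupport f) (x : Plane) :
    ‖f x‖ₑ ≤ ∫⁻ y, ‖partialD 0 (partialD 1 f) y‖ₑ := by
  have h1 := hf.partialD 1
  have h2 := hc.partialD 1
  rw [lintegral_plane_eq _ (h1.partialD 0).continuous.enorm.measurable]
  calc ‖f x‖ₑ = ‖f (x 0 • EuclideanSpace.single 0 (1 : ℝ)
          + x 1 • EuclideanSpace.single 1 (1 : ℝ))‖ₑ := by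
        rw [add_comm, ← plane_eq_add_smul]
    _ ≤ ∫⁻ r : ℝ, ‖partialD 1 f
          (x 0 • EuclideanSpace.single 0 (1 : ℝ) + r • EuclideanSpace.single 1 (1 : ℝ))‖ₑ :=
        enorm_le_lintegral_partialD hf hc 1 _ _
    _ ≤ _ := by
        refine lintegral_mono fun r => ?_
        rw [add_comm]
        exact enorm_le_lintegral_partialD h1 h2 0 _ _

lemma partialD_comm {F : Type*} [NormedAddCommGroup F] [NormedSpace ℝ F]
    {f : Plane → F} (hf : ContDiff ℝ ∞ f) (i j : Fin 2) :
    partialD i (partialD j f) = partialD j (partialD i f) := by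
  ext x
  have hd : DifferentiableAt ℝ (fderiv ℝ f) x :=
    ((hf.fderiv_right (m := ∞) (by simp)).differentiable (by simp)) x
  have hs : IsSymmSndFDerivAt ℝ f x :=
    hf.contDiffAt.isSymmSndFDerivAt (by
      simp only [minSmoothness_of_isRCLikeNormedField]
      exact WithTop.coe_le_coe.2 le_top)
  change fderiv ℝ (fun y => fderiv ℝ f y _) x _ = fderiv ℝ (fun y => fderiv ℝ f y _) x _
  rw [fderiv_clm_apply hd (differentiableAt_const _),
    fderiv_clm_apply hd (differentiableAt_const _)]
  simpa using hs.eq _ _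

/-- The multi-index of `∂₁∂₂`. -/
def MultiIdx.e₁₁ : MultiIdx := ⟨(1, 1), by decide⟩

/-- The multi-index of `∂₁²∂₂`. -/
def MultiIdx.e₂₁ : MultiIdx := ⟨(2, 1), by decide⟩

/-- The multi-index of `∂₁∂₂²`. -/
def MultiIdx.e₁₂ : MultiIdx := ⟨(1, 2), by decide⟩

lemma norm_D_le {Ω : Set Plane} (α : MultiIdx) (f : H3 Ω) : ‖H3.D α f‖ ≤ ‖f‖ :=
  PiLp.norm_apply_le (f : JetSpace Ω) α

lemma tsupport_partialD {F : Type*} [NormedAddCommGroup F] [NormedSpace ℝ F] (i : Fin 2)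
    (f : Plane → F) : tsupport (partialD i f) ⊆ tsupport f :=
  tsupport_fderiv_apply_subset ℝ _

lemma tsupport_multiD {F : Type*} [NormedAddCommGroup F] [NormedSpace ℝ F] (α : MultiIdx)
    (f : Plane → F) : tsupport (multiD α f) ⊆ tsupport f := by
  have key : ∀ (i : Fin 2) (k : ℕ) (g : Plane → F), tsupport ((partialD i)^[k] g) ⊆ tsupport g := by
    intro i k
    induction k with
    | zero => intro g; exact subset_rfl
    | succ k ih => intro g; exact (ih _).trans (tsupport_partialD i g)
  exact (key 0 _ _).trans (key 1 _ _)

/-- The constant of the Sobolev embedding, from the Cauchy-Schwarz inequality on `Ω`. -/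
noncomputable def sobolevConst (Ω : Set Plane) : ℝ := √((volume Ω).toReal)

lemma sobolevConst_nonneg (Ω : Set Plane) : 0 ≤ sobolevConst Ω := Real.sqrt_nonneg _

lemma lintegral_multiD_le {Ω : Set Plane} (hfin : volume Ω ≠ ⊤) {g : Plane → Plane}
    (hg : IsTestFun Ω g) (α : MultiIdx) {f : H3 Ω}
    (hf : H3.D α f =ᵐ[spaceMeasure Ω] multiD α g) :
    ∫⁻ y, ‖multiD α g y‖ₑ ≤ ENNReal.ofReal (sobolevConst Ω * ‖f‖) := by
  have h1 : ∫⁻ y, ‖multiD α g y‖ₑ = ∫⁻ y in Ω, ‖multiD α g y‖ₑ := by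
    refine (setLIntegral_eq_of_support_subset ?_).symm
    intro y hy
    have : y ∈ Function.support (multiD α g) := by
      intro h; apply hy; simp [h]
    exact hg.2.2 (tsupport_multiD α g (subset_tsupport _ this))
  have h2 : ∫⁻ y in Ω, ‖multiD α g y‖ₑ = eLpNorm (H3.D α f) 1 (spaceMeasure Ω) := by
    rw [eLpNorm_congr_ae hf, eLpNorm_one_eq_lintegral_enorm]
  rw [h1, h2]
  refine (eLpNorm_le_eLpNorm_mul_rpow_measure_univ (p := 1) (q := 2) (by norm_num)
    (Lp.aestronglyMeasurable _)).trans ?_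
  have h3 : eLpNorm (H3.D α f) 2 (spaceMeasure Ω) ≤ ENNReal.ofReal ‖f‖ := by
    rw [← Lp.enorm_def, ← ofReal_norm]
    exact ENNReal.ofReal_le_ofReal (norm_D_le α f)
  rw [mul_comm (sobolevConst Ω), ENNReal.ofReal_mul (norm_nonneg _)]
  refine mul_le_mul' h3 ?_
  rw [Measure.restrict_apply_univ, sobolevConst, Real.sqrt_eq_rpow,
    ← ENNReal.ofReal_rpow_of_nonneg ENNReal.toReal_nonneg (by norm_num), ENNReal.ofReal_toReal hfin]
  norm_num

/-- The embedding `H³₀ ⊂ L^∞` for test fields. -/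
lemma norm_test_le {Ω : Set Plane} (hfin : volume Ω ≠ ⊤) {g : Plane → Plane} (hg : IsTestFun Ω g)
    {f : H3 Ω} (hf : ∀ α, H3.D α f =ᵐ[spaceMeasure Ω] multiD α g) (x : Plane) :
    ‖g x‖ ≤ sobolevConst Ω * ‖f‖ := by
  have := (enorm_le_lintegral_mixed hg.1 hg.2.1 x).trans
    (lintegral_multiD_le hfin hg MultiIdx.e₁₁ (hf _))
  rw [← ofReal_norm] at this
  exact (ENNReal.ofReal_le_ofReal_iff
    (mul_nonneg (sobolevConst_nonneg Ω) (norm_nonneg _))).1 this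

/-- The embedding `H³₀ ⊂ W^{1,∞}` for test fields: the mixed second derivative of `∂ᵢ g` is of
order three. -/
lemma norm_partialD_test_le {Ω : Set Plane} (hfin : volume Ω ≠ ⊤) {g : Plane → Plane}
    (hg : IsTestFun Ω g) {f : H3 Ω} (hf : ∀ α, H3.D α f =ᵐ[spaceMeasure Ω] multiD α g) (i : Fin 2) (x : Plane) :
    ‖partialD i g x‖ ≤ sobolevConst Ω * ‖f‖ := by
  have key : ∫⁻ y, ‖partialD 0 (partialD 1 (partialD i g)) y‖ₑ
      ≤ ENNReal.ofReal (sobolevConst Ω * ‖f‖) := by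
    fin_cases i
    · have h := lintegral_multiD_le hfin hg MultiIdx.e₂₁ (hf _)
      have e : multiD MultiIdx.e₂₁ g = partialD 0 (partialD 1 (partialD 0 g)) := by
        rw [partialD_comm hg.1 1 0]; rfl
      rwa [e] at h
    · exact lintegral_multiD_le hfin hg MultiIdx.e₁₂ (hf _)
  have := (enorm_le_lintegral_mixed (hg.1.partialD i) (hg.2.1.partialD i) x).trans key
  rw [← ofReal_norm] at this
  exact (ENNReal.ofReal_le_ofReal_iff
    (mul_nonneg (sobolevConst_nonneg Ω) (norm_nonneg _))).1 this

lemma norm_fderiv_test_le {Ω : Set Plane} (hfin : volume Ω ≠ ⊤) {g : Plane → Plane}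
    (hg : IsTestFun Ω g) {f : H3 Ω} (hf : ∀ α, H3.D α f =ᵐ[spaceMeasure Ω] multiD α g) (x w : Plane) :
    ‖fderiv ℝ g x w‖ ≤ 2 * sobolevConst Ω * ‖f‖ * ‖w‖ := by
  have hw : ∀ i, |w i| ≤ ‖w‖ := fun i => by simpa using PiLp.norm_apply_le w i
  have e : fderiv ℝ g x w = w 1 • partialD 1 g x + w 0 • partialD 0 g x := by
    conv_lhs => rw [plane_eq_add_smul w]
    simp [partialD]
  rw [e]
  have h0 := norm_partialD_test_le hfin hg hf 0 x
  have h1 := norm_partialD_test_le hfin hg hf 1 x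
  calc _ ≤ |w 1| * ‖partialD 1 g x‖ + |w 0| * ‖partialD 0 g x‖ := by
        refine (norm_add_le _ _).trans ?_
        rw [norm_smul, norm_smul]; rfl
    _ ≤ ‖w‖ * (sobolevConst Ω * ‖f‖) + ‖w‖ * (sobolevConst Ω * ‖f‖) := by
        gcongr <;> apply hw
    _ = _ := by ring

/-! ### Approximate characteristics -/

/-- `φ` solves the backward equation `∂ₜφ + β·∇φ = 0` with final value `ζ` at time `τ` up to a
residual `A * r`, where `A` bounds the spatial gradient. The field `β` is already built on times
`≥ s`, and vanishes for times `≤ s`, where `φ` does not depend on time. -/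
structure ApproxBackward (Ω : Set Plane) (ζ : Plane → ℝ) (τ r s A : ℝ)
    (β : ℝ → Plane → Plane) (φ : ℝ × Plane → ℝ) : Prop where
  smooth : ContDiff ℝ ∞ φ
  supp : ∃ K, IsCompact K ∧ K ⊆ Ω ∧ ∀ t x, x ∉ K → φ (t, x) = 0
  grad : ∀ p y, |fderiv ℝ φ p (0, y)| ≤ A * ‖y‖
  terminal : ∀ t x, τ ≤ t → φ (t, x) = ζ x
  stationary : ∀ t x, t ≤ s → fderiv ℝ φ (t, x) (1, 0) = 0
  field_zero : ∀ t x, t ≤ s → β t x = 0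
  residual : ∀ t x, |fderiv ℝ φ (t, x) (1, β t x)| ≤ A * r

/-- The time-independent function `ζ` solves the backward equation for the zero field. -/
lemma ApproxBackward.init {Ω : Set Plane} {ζ : Plane → ℝ} (hζ : IsTestFun Ω ζ) {A r : ℝ}
    (hA : ∀ x y, |fderiv ℝ ζ x y| ≤ A * ‖y‖) (hr : 0 ≤ A * r) (τ : ℝ) :
    ApproxBackward Ω ζ τ r τ A (fun _ _ => 0) (fun p => ζ p.2) := by
  have hd : ∀ (p : ℝ × Plane) v, fderiv ℝ (fun p : ℝ × Plane => ζ p.2) p v = fderiv ℝ ζ p.2 v.2 := by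
    intro p v
    have := ((hζ.1.differentiable (by simp)) p.2).hasFDerivAt.comp p
      (hasFDerivAt_snd (𝕜 := ℝ) (E := ℝ) (F := Plane) (p := p))
    exact congrArg (fun l => l v) this.fderiv
  refine ⟨hζ.1.comp contDiff_snd, ⟨tsupport ζ, hζ.2.1, hζ.2.2, fun t x hx =>
    image_eq_zero_of_notMem_tsupport hx⟩, ?_, fun _ _ _ => rfl, ?_, fun _ _ _ => rfl, ?_⟩
  · intro p y; rw [hd]; exact hA _ _
  · intro t x _; rw [hd]; simp
  · intro t x; rw [hd]; simpa using hr

/-- One backward Euler step: composition with `x ↦ x + Θ(t) g(x)`, `Θ(t) = ∫ₜ θ`, adds the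
piece `θ(t) g(x)` to the field. -/
lemma ApproxBackward.step {Ω : Set Plane} {ζ : Plane → ℝ} {τ r s s' A : ℝ}
    {β : ℝ → Plane → Plane} {φ : ℝ × Plane → ℝ} (h : ApproxBackward Ω ζ τ r s A β φ)
    (hA : 0 ≤ A) (hsτ : s ≤ τ) (hs : s' ≤ s)
    {θ : ℝ → ℝ} (hθ : ContDiff ℝ ∞ θ) (hθ0 : ∀ t, 0 ≤ θ t) (hθ1 : ∀ t, θ t ≤ 1)
    (hθs : ∀ t, t ∉ Ioo s' s → θ t = 0)
    {g : Plane → Plane} (hg : IsTestFun Ω g) {L M : ℝ} (hL0 : 0 ≤ L) (hM0 : 0 ≤ M)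
    (hL : ∀ x w, ‖fderiv ℝ g x w‖ ≤ L * ‖w‖) (hM : ∀ x, ‖g x‖ ≤ M)
    (hr : (∫ t, θ t) * L * M ≤ r) :
    ∃ φ', ApproxBackward Ω ζ τ r s' (A * (1 + (∫ t, θ t) * L))
      (fun t x => β t x + θ t • g x) φ' := by
  set m := ∫ t, θ t with hm
  have hθc : Continuous θ := hθ.continuous
  have hθint : Integrable θ := by
    refine hθc.integrable_of_hasCompactSupport ?_
    exact HasCompactSupport.intro (isCompact_Icc (a := s') (b := s))
      fun t ht => hθs t fun h' => ht (Ioo_subset_Icc_self h')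
  have hm0 : 0 ≤ m := integral_nonneg hθ0
  set Θ : ℝ → ℝ := fun t => ∫ u in t..s, θ u with hΘ
  have hΘd : ∀ t, HasDerivAt Θ (-θ t) t := fun t =>
    intervalIntegral.integral_hasDerivAt_left (hθc.intervalIntegrable _ _)
      (hθc.stronglyMeasurableAtFilter _ _) hθc.continuousAt
  have hΘsm : ContDiff ℝ ∞ Θ := by
    rw [contDiff_infty_iff_deriv]
    refine ⟨fun t => (hΘd t).differentiableAt, ?_⟩
    rw [show deriv Θ = fun t => -θ t from funext fun t => (hΘd t).deriv]
    exact hθ.neg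
  have hΘz : ∀ t, s ≤ t → Θ t = 0 := by
    intro t ht
    apply intervalIntegral.integral_zero_ae
    refine Eventually.of_forall fun u hu => hθs u fun h' => ?_
    rw [uIoc_of_ge ht] at hu
    exact absurd h'.2 (not_lt.2 hu.1.le)
  have hΘb : ∀ t, 0 ≤ Θ t ∧ Θ t ≤ m := by
    intro t
    rcases le_total s t with ht | ht
    · rw [hΘz t ht]; exact ⟨le_rfl, hm0⟩
    · rw [hΘ]; simp only [intervalIntegral.integral_of_le ht]
      exact ⟨integral_nonneg hθ0,
        setIntegral_le_integral hθint (Eventually.of_forall hθ0)⟩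
  set F : ℝ × Plane → ℝ × Plane := fun p => (p.1, p.2 + Θ p.1 • g p.2) with hF
  have hgs : ContDiff ℝ ∞ g := hg.1
  have hFsm : ContDiff ℝ ∞ F :=
    contDiff_fst.prodMk (contDiff_snd.add ((hΘsm.comp contDiff_fst).smul (hgs.comp contDiff_snd)))
  have hd : ∀ t x a w, fderiv ℝ (φ ∘ F) (t, x) (a, w)
      = fderiv ℝ φ (t, x + Θ t • g x) (a, w + (Θ t • fderiv ℝ g x w - (a * θ t) • g x)) := by
    intro t x a w
    have h1 : HasFDerivAt (fun p : ℝ × Plane => Θ p.1)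
        ((ContinuousLinearMap.toSpanSingleton ℝ (-θ t)).comp (ContinuousLinearMap.fst ℝ ℝ Plane))
        (t, x) :=
      HasFDerivAt.comp (t, x) (f := Prod.fst) (g := Θ) (hΘd t).hasFDerivAt hasFDerivAt_fst
    have h2 : HasFDerivAt (fun p : ℝ × Plane => g p.2)
        ((fderiv ℝ g x).comp (ContinuousLinearMap.snd ℝ ℝ Plane)) (t, x) :=
      HasFDerivAt.comp (t, x) (f := Prod.snd) (g := g)
        ((hgs.differentiable (by simp)) x).hasFDerivAt hasFDerivAt_snd
    have h3 : HasFDerivAt F _ (t, x) :=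
      hasFDerivAt_fst.prodMk (hasFDerivAt_snd.add (h1.smul h2))
    have h4 := (((h.smooth.differentiable (by simp)) (F (t, x))).hasFDerivAt.comp (t, x) h3).fderiv
    rw [h4]
    simp [hF, sub_eq_add_neg]
  have hsplit : ∀ p (a : ℝ) (w : Plane),
      fderiv ℝ φ p (a, w) = a * fderiv ℝ φ p (1, 0) + fderiv ℝ φ p (0, w) := by
    intro p a w
    rw [show ((a, w) : ℝ × Plane) = a • (1, 0) + (0, w) by simp, map_add, map_smul, smul_eq_mul]
  -- the gradient bound only grows, so a residual at most `A * r` stays admissible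
  have hAA : A ≤ A * (1 + m * L) := by nlinarith [mul_nonneg hA (mul_nonneg hm0 hL0)]
  refine ⟨φ ∘ F, ?_, ?_, ?_, ?_, ?_, ?_, ?_⟩
  · exact h.smooth.comp hFsm
  · obtain ⟨K, hK, hKΩ, hK0⟩ := h.supp
    refine ⟨K ∪ tsupport g, hK.union hg.2.1, union_subset hKΩ hg.2.2, fun t x hx => ?_⟩
    rw [mem_union, not_or] at hx
    simp only [hF, Function.comp, image_eq_zero_of_notMem_tsupport hx.2, smul_zero, add_zero]
    exact hK0 t x hx.1
  · rintro ⟨t, x⟩ y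
    rw [hd]
    refine (h.grad _ _).trans ?_
    have : ‖y + (Θ t • fderiv ℝ g x y - (0 * θ t) • g x)‖ ≤ ‖y‖ + m * (L * ‖y‖) := by
      rw [zero_mul, zero_smul, sub_zero]
      refine (norm_add_le _ _).trans (add_le_add le_rfl ?_)
      rw [norm_smul, Real.norm_of_nonneg (hΘb t).1]
      exact mul_le_mul (hΘb t).2 (hL x y) (norm_nonneg _) hm0
    calc _ ≤ A * (‖y‖ + m * (L * ‖y‖)) := by gcongr
      _ = _ := by ring
  · intro t x ht
    simp only [hF, Function.comp, hΘz t (hsτ.trans ht), zero_smul, add_zero]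
    exact h.terminal t x ht
  · intro t x ht
    have ht0 : θ t = 0 := hθs t fun h' => absurd h'.1 (not_lt.2 ht)
    rw [hd, ht0]
    simpa using h.stationary t _ (ht.trans hs)
  · intro t x ht
    have ht0 : θ t = 0 := hθs t fun h' => absurd h'.1 (not_lt.2 ht)
    simp [ht0, h.field_zero t x (ht.trans hs)]
  · intro t x
    have hr0 : 0 ≤ r := le_trans (by positivity) hr
    refine le_trans ?_ (mul_le_mul_of_nonneg_right hAA hr0)
    rw [hd]
    -- For `t ≥ s` the composition is trivial. For `t < s` the function `φ` is stationary and only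
    -- the new piece is active; its transport term is cancelled up to `Θ(t) θ(t) Dg(x) g(x)`.
    rcases le_or_gt s t with ht | ht
    · have ht0 : θ t = 0 := hθs t fun h' => absurd h'.2 (not_lt.2 ht)
      rw [ht0, hΘz t ht]
      simpa using h.residual t x
    · rw [h.field_zero t x ht.le, hsplit, h.stationary t _ ht.le, mul_zero, zero_add]
      refine (h.grad _ _).trans (mul_le_mul_of_nonneg_left ?_ hA)
      have e : (0 : Plane) + θ t • g x + (Θ t • fderiv ℝ g x (0 + θ t • g x) - (1 * θ t) • g x)
          = Θ t • θ t • fderiv ℝ g x (g x) := by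
        simp
      rw [e, norm_smul, norm_smul, Real.norm_of_nonneg (hΘb t).1, Real.norm_of_nonneg (hθ0 t)]
      refine le_trans ?_ hr
      calc Θ t * (θ t * ‖fderiv ℝ g x (g x)‖) ≤ m * (1 * (L * M)) := by
            refine mul_le_mul (hΘb t).2 ?_ (mul_nonneg (hθ0 t) (norm_nonneg _)) hm0
            refine mul_le_mul (hθ1 t) ?_ (norm_nonneg _) zero_le_one
            exact (hL x _).trans (mul_le_mul_of_nonneg_left (hM x) hL0)
        _ = _ := by ring

/-- Iteration of `ApproxBackward.step` over a decreasing sequence of times. -/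
lemma ApproxBackward.exists_iterate {Ω : Set Plane} {ζ : Plane → ℝ} (hζ : IsTestFun Ω ζ) {A r : ℝ}
    (hA0 : 0 ≤ A) (hr0 : 0 ≤ r) (hA : ∀ x y, |fderiv ℝ ζ x y| ≤ A * ‖y‖)
    {s : ℕ → ℝ} (hs : Antitone s) {θ : ℕ → ℝ → ℝ} (hθ : ∀ j, ContDiff ℝ ∞ (θ j))
    (hθ0 : ∀ j t, 0 ≤ θ j t) (hθ1 : ∀ j t, θ j t ≤ 1)
    (hθs : ∀ j t, t ∉ Ioo (s (j + 1)) (s j) → θ j t = 0)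
    {g : ℕ → Plane → Plane} (hg : ∀ j, IsTestFun Ω (g j)) {L M : ℕ → ℝ} (hL0 : ∀ j, 0 ≤ L j)
    (hM0 : ∀ j, 0 ≤ M j) (hL : ∀ j x w, ‖fderiv ℝ (g j) x w‖ ≤ L j * ‖w‖)
    (hM : ∀ j x, ‖g j x‖ ≤ M j) (hr : ∀ j, (∫ t, θ j t) * L j * M j ≤ r) (n : ℕ) :
    ∃ φ, ApproxBackward Ω ζ (s 0) r (s n) (A * ∏ j ∈ Finset.range n, (1 + (∫ t, θ j t) * L j))
      (fun t x => ∑ j ∈ Finset.range n, θ j t • g j x) φ := by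
  induction n with
  | zero =>
    simpa using ⟨_, ApproxBackward.init hζ hA (mul_nonneg hA0 hr0) (s 0)⟩
  | succ n ih =>
    obtain ⟨φ, hφ⟩ := ih
    have h0 : ∀ j, 0 ≤ ∫ t, θ j t := fun j => integral_nonneg (hθ0 j)
    have hA' : 0 ≤ A * ∏ j ∈ Finset.range n, (1 + (∫ t, θ j t) * L j) :=
      mul_nonneg hA0 (Finset.prod_nonneg fun j _ => by
        have := mul_nonneg (h0 j) (hL0 j); linarith)
    obtain ⟨φ', hφ'⟩ := hφ.step hA' (hs (Nat.zero_le n)) (hs n.le_succ) (hθ n) (hθ0 n) (hθ1 n)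
      (hθs n) (hg n) (hL0 n) (hM0 n) (hL n) (hM n) (hr n)
    refine ⟨φ', ?_⟩
    simpa only [Finset.prod_range_succ, Finset.sum_range_succ, mul_assoc] using hφ'

/-! ### The spaces of compactly supported and divergence-free fields -/

lemma multiD_add {F : Type*} [NormedAddCommGroup F] [NormedSpace ℝ F] (α : MultiIdx)
    {f g : Plane → F} (hf : ContDiff ℝ ∞ f) (hg : ContDiff ℝ ∞ g) :
    multiD α (f + g) = multiD α f + multiD α g := by
  have key : ∀ (i : Fin 2) (k : ℕ) (f g : Plane → F), ContDiff ℝ ∞ f → ContDiff ℝ ∞ g →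
      (partialD i)^[k] (f + g) = (partialD i)^[k] f + (partialD i)^[k] g
        ∧ ContDiff ℝ ∞ ((partialD i)^[k] f) := by
    intro i k
    induction k with
    | zero => intro f g hf hg; exact ⟨rfl, hf⟩
    | succ k ih =>
      intro f g hf hg
      have e : partialD i (f + g) = partialD i f + partialD i g := by
        ext1 x
        simp only [partialD, Pi.add_apply]
        rw [fderiv_add (hf.differentiable (by simp) x) (hg.differentiable (by simp) x)]
        rfl
      simp only [Function.iterate_succ, Function.comp, e]
      exact ih _ _ (hf.partialD i) (hg.partialD i)
  rw [multiD, (key 1 _ f g hf hg).1, (key 0 _ _ _ (key 1 _ f g hf hg).2 (key 1 _ g f hg hf).2).1]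
  rfl

lemma multiD_const_smul {F : Type*} [NormedAddCommGroup F] [NormedSpace ℝ F] (α : MultiIdx)
    (c : ℝ) {f : Plane → F} (hf : ContDiff ℝ ∞ f) : multiD α (c • f) = c • multiD α f := by
  have key : ∀ (i : Fin 2) (k : ℕ) (f : Plane → F), ContDiff ℝ ∞ f →
      (partialD i)^[k] (c • f) = c • (partialD i)^[k] f
        ∧ ContDiff ℝ ∞ ((partialD i)^[k] f) := by
    intro i k
    induction k with
    | zero => intro f hf; exact ⟨rfl, hf⟩
    | succ k ih =>
      intro f hf
      have e : partialD i (c • f) = c • partialD i f := by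
        ext1 x
        simp only [partialD, Pi.smul_apply]
        rw [fderiv_const_smul (hf.differentiable (by simp) x)]
        rfl
      simp only [Function.iterate_succ, Function.comp, e]
      exact ih _ (hf.partialD i)
  rw [multiD, (key 1 _ f hf).1, (key 0 _ _ (key 1 _ f hf).2).1]
  rfl

lemma IsTestFun.add {F : Type*} [NormedAddCommGroup F] [NormedSpace ℝ F] {Ω : Set Plane}
    {f g : Plane → F} (hf : IsTestFun Ω f) (hg : IsTestFun Ω g) : IsTestFun Ω (f + g) :=
  ⟨hf.1.add hg.1, hf.2.1.add hg.2.1, (tsupport_add f g).trans (union_subset hf.2.2 hg.2.2)⟩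

lemma IsTestFun.const_smul {F : Type*} [NormedAddCommGroup F] [NormedSpace ℝ F] {Ω : Set Plane}
    {f : Plane → F} (hf : IsTestFun Ω f) (c : ℝ) : IsTestFun Ω (c • f) :=
  ⟨hf.1.const_smul c, hf.2.1.smul_left (f := fun _ => c),
    (tsupport_smul_subset_right (fun _ => c) f).trans hf.2.2⟩

lemma IsTestFun.zero {F : Type*} [NormedAddCommGroup F] [NormedSpace ℝ F] {Ω : Set Plane} :
    IsTestFun Ω (0 : Plane → F) := by
  refine ⟨contDiff_const, HasCompactSupport.zero, ?_⟩
  rw [tsupport_eq_empty_iff.2 rfl]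
  exact empty_subset _

/-- `f ∈ H³(Ω)²` is represented by the test field `g`. -/
def IsJetOf {Ω : Set Plane} (f : H3 Ω) (g : Plane → Plane) : Prop :=
  IsTestFun Ω g ∧ ∀ α, H3.D α f =ᵐ[spaceMeasure Ω] multiD α g

/-- The elements of `H³(Ω)²` represented by test fields. -/
noncomputable def testSubmodule (Ω : Set Plane) : Submodule ℝ (H3 Ω) where
  carrier := {f | ∃ g, IsJetOf f g}
  zero_mem' := by
    refine ⟨0, IsTestFun.zero, fun α => ?_⟩
    have e : multiD α (0 : Plane → Plane) = 0 := by
      simpa using multiD_const_smul (F := Plane) α 0 (f := 0) contDiff_const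
    rw [e]
    exact Lp.coeFn_zero _ _ _
  add_mem' := by
    rintro f f' ⟨g, hg, hfg⟩ ⟨g', hg', hfg'⟩
    refine ⟨g + g', hg.add hg', fun α => ?_⟩
    rw [multiD_add α hg.1 hg'.1]
    exact (Lp.coeFn_add (H3.D α f) (H3.D α f')).trans ((hfg α).add (hfg' α))
  smul_mem' := by
    rintro c f ⟨g, hg, hfg⟩
    refine ⟨c • g, hg.const_smul c, fun α => ?_⟩
    rw [multiD_const_smul α c hg.1]
    exact (Lp.coeFn_smul c (H3.D α f)).trans ((hfg α).const_smul c)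

/-- `H³₀(Ω)²` as a closed subspace of `H³(Ω)²`. -/
noncomputable def H30Sub (Ω : Set Plane) : Submodule ℝ (H3 Ω) :=
  (testSubmodule Ω).topologicalClosure

/-- `H³₀(Ω)²` as a normed space in its own right. It is a separate type, not reducible to the
subspace, so that instance search does not descend into the nested subspaces of `JetSpace Ω`. -/
def H30Space (Ω : Set Plane) : Type := H30Sub Ω

noncomputable instance (Ω : Set Plane) : NormedAddCommGroup (H30Space Ω) :=
  inferInstanceAs (NormedAddCommGroup (H30Sub Ω))

noncomputable instance (Ω : Set Plane) : NormedSpace ℝ (H30Space Ω) :=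
  inferInstanceAs (NormedSpace ℝ (H30Sub Ω))

/-- The inclusion `H³₀(Ω)² → H³(Ω)²`. -/
noncomputable def H30Space.incl (Ω : Set Plane) : H30Space Ω →ₗᵢ[ℝ] H3 Ω :=
  (H30Sub Ω).subtypeₗᵢ

lemma H30Space.incl_mem {Ω : Set Plane} (f : H30Space Ω) : incl Ω f ∈ H30 Ω :=
  Subtype.property (p := (· ∈ H30Sub Ω)) f

lemma H30Space.exists_incl_eq {Ω : Set Plane} {f : H3 Ω} (hf : f ∈ H30 Ω) :
    ∃ g : H30Space Ω, incl Ω g = f := ⟨⟨f, hf⟩, rfl⟩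

/-- The derivative `∂^α` as a continuous linear map `H³(Ω)² → L²(Ω)²`. -/
noncomputable def derivCLM (Ω : Set Plane) (α : MultiIdx) :
    H3 Ω →L[ℝ] Lp Plane 2 (spaceMeasure Ω) :=
  (PiLp.proj 2 (fun _ : MultiIdx => Lp Plane 2 (spaceMeasure Ω)) α).comp (H3 Ω).subtypeL

/-- The divergence as a continuous linear map `H³(Ω)² → L²(Ω)`. -/
noncomputable def divCLM (Ω : Set Plane) : H3 Ω →L[ℝ] Lp ℝ 2 (spaceMeasure Ω) :=
  ((EuclideanSpace.proj 0 : Plane →L[ℝ] ℝ).compLpL 2 (spaceMeasure Ω)).comp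
      (derivCLM Ω MultiIdx.e₁)
    + ((EuclideanSpace.proj 1 : Plane →L[ℝ] ℝ).compLpL 2 (spaceMeasure Ω)).comp
      (derivCLM Ω MultiIdx.e₂)

lemma divCLM_eq_zero_iff {Ω : Set Plane} (f : H3 Ω) : divCLM Ω f = 0 ↔
    ∀ᵐ x ∂(spaceMeasure Ω), H3.D MultiIdx.e₁ f x 0 + H3.D MultiIdx.e₂ f x 1 = 0 := by
  have h : divCLM Ω f =ᵐ[spaceMeasure Ω]
      fun x => H3.D MultiIdx.e₁ f x 0 + H3.D MultiIdx.e₂ f x 1 := by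
    refine (Lp.coeFn_add _ _).trans ?_
    filter_upwards [(EuclideanSpace.proj 0 : Plane →L[ℝ] ℝ).coeFn_compLpL (derivCLM Ω MultiIdx.e₁ f),
      (EuclideanSpace.proj 1 : Plane →L[ℝ] ℝ).coeFn_compLpL (derivCLM Ω MultiIdx.e₂ f)] with x h1 h2
    exact congrArg₂ (· + ·) h1 h2
  rw [Lp.eq_zero_iff_ae_eq_zero]
  exact ⟨fun h0 => h.symm.trans h0, fun h0 => h.trans h0⟩

/-- `H^{3,div}₀(Ω)²` as a subspace of `H³(Ω)²`. -/
noncomputable def H30divSub (Ω : Set Plane) : Submodule ℝ (H3 Ω) :=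
  H30Sub Ω ⊓ (divCLM Ω).ker

lemma mem_H30divSub {Ω : Set Plane} {f : H3 Ω} : f ∈ H30divSub Ω ↔ f ∈ H30div Ω :=
  and_congr Iff.rfl ((LinearMap.mem_ker).trans (divCLM_eq_zero_iff f))

lemma isClosed_H30divSub (Ω : Set Plane) : IsClosed (H30divSub Ω : Set (H3 Ω)) :=
  (Submodule.isClosed_topologicalClosure _).inter (divCLM Ω).isClosed_ker

/-- Taking values in a closed subspace almost everywhere passes to weak limits in `L^p`: it is
the kernel of the continuous linear map induced by the quotient map, and continuous functionals
separate points. -/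
lemma ae_mem_of_weaklyConverges {X E : Type*} [MeasurableSpace X] {μ : Measure X}
    [NormedAddCommGroup E] [NormedSpace ℝ E] {p : ℝ≥0∞} [Fact (1 ≤ p)]
    (W : Submodule ℝ E) [hW : IsClosed (W : Set E)] {b : Lp E p μ} {bn : ℕ → Lp E p μ}
    (hbn : ∀ n, ∀ᵐ t ∂μ, bn n t ∈ W) (hw : WeaklyConverges bn b) : ∀ᵐ t ∂μ, b t ∈ W := by
  set q : Lp E p μ →L[ℝ] Lp (E ⧸ W) p μ := W.mkQL.compLpL p μ with hq
  have key : ∀ c : Lp E p μ, q c = 0 ↔ ∀ᵐ t ∂μ, c t ∈ W := by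
    intro c
    rw [Lp.eq_zero_iff_ae_eq_zero]
    have h1 := W.mkQL.coeFn_compLpL (p := p) (μ := μ) c
    have h2 : ∀ᵐ t ∂μ, (q c t = 0 ↔ c t ∈ W) := by
      filter_upwards [h1] with t ht
      rw [hq, ht]
      exact Submodule.Quotient.mk_eq_zero _
    exact ⟨fun h => by filter_upwards [h, h2] with t ht ht2 using ht2.1 ht,
      fun h => by filter_upwards [h, h2] with t ht ht2 using ht2.2 ht⟩
  rw [← key]
  refine SeparatingDual.eq_zero_of_forall_dual_eq_zero (R := ℝ) fun l => ?_
  have h3 := hw (l.comp q)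
  have h4 : ∀ n, (l.comp q) (bn n) = 0 := fun n => by
    rw [ContinuousLinearMap.comp_apply, (key _).2 (hbn n), map_zero]
  simp only [h4] at h3
  exact tendsto_nhds_unique h3 tendsto_const_nhds

lemma MemL2H30div.of_weaklyConverges {T : ℝ} {Ω : Set Plane} {b : L2H3 T Ω} {bn : ℕ → L2H3 T Ω}
    (hbn : ∀ n, MemL2H30div (bn n)) (hw : WeaklyConverges bn b) : MemL2H30div b := by
  have := ae_mem_of_weaklyConverges (H30divSub Ω) (hW := isClosed_H30divSub Ω)
    (fun n => (hbn n).mono fun t ht => mem_H30divSub.2 ht) hw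
  exact this.mono fun t ht => mem_H30divSub.1 ht

/-- The Sobolev inequality extends from test fields to `H³₀(Ω)²` by density. -/
lemma ae_norm_val_le {Ω : Set Plane} (hfin : volume Ω ≠ ⊤) {f : H3 Ω} (hf : f ∈ H30 Ω) :
    ∀ᵐ x ∂(spaceMeasure Ω), ‖H3.val f x‖ ≤ sobolevConst Ω * ‖f‖ := by
  obtain ⟨F, hF, hlim⟩ := mem_closure_iff_seq_limit.1 hf
  have h1 : Tendsto (fun n => H3.val (F n)) atTop (𝓝 (H3.val f)) :=
    ((derivCLM Ω MultiIdx.zero).continuous.tendsto f).comp hlim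
  obtain ⟨ns, hns, hae⟩ := (tendstoInMeasure_of_tendsto_Lp h1).exists_seq_tendsto_ae
  have h2 : ∀ᵐ x ∂(spaceMeasure Ω), ∀ n, ‖H3.val (F n) x‖ ≤ sobolevConst Ω * ‖F n‖ := by
    rw [ae_all_iff]
    intro n
    obtain ⟨g, hg, hfg⟩ := hF n
    filter_upwards [hfg MultiIdx.zero] with x hx
    have : H3.val (F n) x = g x := hx
    rw [this]
    exact norm_test_le hfin hg hfg x
  filter_upwards [hae, h2] with x hx hx2
  have h3 : Tendsto (fun n => sobolevConst Ω * ‖F (ns n)‖) atTop (𝓝 (sobolevConst Ω * ‖f‖)) :=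
    (hlim.norm.const_mul _).comp hns.tendsto_atTop
  exact le_of_tendsto_of_tendsto' hx.norm h3 fun n => hx2 (ns n)

lemma norm_toLp_top_le {X E : Type*} [MeasurableSpace X] {μ : Measure X} [NormedAddCommGroup E]
    {f : X → E} {C : ℝ} (hC : 0 ≤ C) (hf : MemLp f ⊤ μ) (h : ∀ᵐ x ∂μ, ‖f x‖ ≤ C) :
    ‖hf.toLp f‖ ≤ C := by
  rw [Lp.norm_toLp, eLpNorm_exponent_top]
  exact ENNReal.toReal_le_of_le_ofReal hC (eLpNormEssSup_le_of_ae_bound h)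

lemma memLp_top_val {Ω : Set Plane} (hfin : volume Ω ≠ ⊤) (f : H30Space Ω) :
    MemLp (H3.val (H30Space.incl Ω f)) ⊤ (spaceMeasure Ω) :=
  memLp_top_of_bound (Lp.aestronglyMeasurable _) _ (ae_norm_val_le hfin f.incl_mem)

/-- The Sobolev embedding `H³₀(Ω)² → L^∞(Ω)²`. -/
noncomputable def supEmbedding {Ω : Set Plane} (hfin : volume Ω ≠ ⊤) :
    H30Space Ω →L[ℝ] Lp Plane ⊤ (spaceMeasure Ω) :=
  LinearMap.mkContinuous
    { toFun := fun f => (memLp_top_val hfin f).toLp _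
      map_add' := by
        intro f g
        rw [← MemLp.toLp_add]
        refine MemLp.toLp_congr _ _ ?_
        rw [map_add]
        exact Lp.coeFn_add (H3.val (H30Space.incl Ω f)) (H3.val (H30Space.incl Ω g))
      map_smul' := by
        intro c f
        rw [RingHom.id_apply, ← MemLp.toLp_const_smul]
        refine MemLp.toLp_congr _ _ ?_
        rw [map_smul]
        exact Lp.coeFn_smul c (H3.val (H30Space.incl Ω f)) }
    (sobolevConst Ω) fun f =>
      norm_toLp_top_le (mul_nonneg (sobolevConst_nonneg _) (norm_nonneg _)) (memLp_top_val hfin f)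
        (by simpa only [LinearIsometry.norm_map] using ae_norm_val_le hfin f.incl_mem)

lemma coeFn_supEmbedding {Ω : Set Plane} (hfin : volume Ω ≠ ⊤) (f : H30Space Ω) :
    supEmbedding hfin f =ᵐ[spaceMeasure Ω] H3.val (H30Space.incl Ω f) :=
  (memLp_top_val hfin f).coeFn_toLp

/-- A Bochner function with values in a subspace almost everywhere lifts to the subspace. -/
lemma exists_Lp_lift {X E V : Type*} [MeasurableSpace X] {μ : Measure X}
    [NormedAddCommGroup E] [NormedSpace ℝ E] [NormedAddCommGroup V] [NormedSpace ℝ V] {p : ℝ≥0∞}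
    (i : V →ₗᵢ[ℝ] E) (b : Lp E p μ) (hb : ∀ᵐ t ∂μ, b t ∈ range i) :
    ∃ b' : Lp V p μ, (∀ᵐ t ∂μ, i (b' t) = b t) ∧ ‖b'‖ = ‖b‖ := by
  classical
  set f : X → V := fun t => if h : b t ∈ range i then h.choose else 0 with hf
  have hfb : ∀ᵐ t ∂μ, i (f t) = b t := by
    filter_upwards [hb] with t ht
    rw [hf]
    simp only [dif_pos ht]
    exact ht.choose_spec
  have hm : AEStronglyMeasurable f μ := by
    rw [← i.isometry.isEmbedding.aestronglyMeasurable_comp_iff]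
    exact (Lp.aestronglyMeasurable b).congr (hfb.mono fun t ht => ht.symm)
  have hn : eLpNorm f p μ = eLpNorm b p μ := by
    refine eLpNorm_congr_norm_ae ?_
    filter_upwards [hfb] with t ht
    rw [← ht, i.norm_map]
  have hL : MemLp f p μ := ⟨hm, by rw [hn]; exact (Lp.memLp b).2⟩
  refine ⟨hL.toLp f, ?_, ?_⟩
  · filter_upwards [hL.coeFn_toLp, hfb] with t h1 h2
    rw [h1, h2]
  · rw [Lp.norm_toLp, hn, Lp.norm_def]

lemma MemL2H30div.exists_lift {T : ℝ} {Ω : Set Plane} {b : L2H3 T Ω} (hb : MemL2H30div b) :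
    ∃ b' : Lp (H30Space Ω) 2 (timeMeasure T),
      (∀ᵐ t ∂(timeMeasure T), H30Space.incl Ω (b' t) = b t) ∧ ‖b'‖ = ‖b‖ :=
  exists_Lp_lift (H30Space.incl Ω) b (hb.mono fun _ ht => H30Space.exists_incl_eq ht.1)

/-! ### The weak formulation as a continuous pairing -/

section Slice
variable {F : Type*} [NormedAddCommGroup F] {k : ℝ × Plane → F}

lemma memLp_slice (hk : Continuous k) (hc : HasCompactSupport k) (μ : Measure Plane) (t : ℝ) :
    MemLp (fun x => k (t, x)) ⊤ μ := by
  obtain ⟨C, hC⟩ := hk.bounded_above_of_compact_support hc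
  exact memLp_top_of_bound (hk.comp (by fun_prop)).aestronglyMeasurable C
    (Eventually.of_forall fun x => hC _)

/-- The slice `k(t, ·)` as an element of `L^∞`. -/
noncomputable def sliceLp (hk : Continuous k) (hc : HasCompactSupport k) (μ : Measure Plane)
    (t : ℝ) : Lp F ⊤ μ := (memLp_slice hk hc μ t).toLp _

lemma coeFn_sliceLp (hk : Continuous k) (hc : HasCompactSupport k) (μ : Measure Plane) (t : ℝ) :
    sliceLp hk hc μ t =ᵐ[μ] fun x => k (t, x) := (memLp_slice hk hc μ t).coeFn_toLp

lemma norm_sliceLp_le (hk : Continuous k) (hc : HasCompactSupport k) (μ : Measure Plane) {C : ℝ}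
    (hC : ∀ p, ‖k p‖ ≤ C) (t : ℝ) : ‖sliceLp hk hc μ t‖ ≤ C :=
  norm_toLp_top_le ((norm_nonneg _).trans (hC (0, 0))) _ (Eventually.of_forall fun _ => hC _)

lemma continuous_sliceLp (hk : Continuous k) (hc : HasCompactSupport k) (μ : Measure Plane) :
    Continuous (sliceLp hk hc μ) := by
  have hu := hc.uniformContinuous_of_continuous hk
  rw [Metric.continuous_iff]
  intro t ε hε
  obtain ⟨δ, hδ, h⟩ := Metric.uniformContinuous_iff.1 hu (ε / 2) (half_pos hε)
  refine ⟨δ, hδ, fun s hs => ?_⟩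
  rw [dist_eq_norm, sliceLp, sliceLp, ← MemLp.toLp_sub]
  refine lt_of_le_of_lt (norm_toLp_top_le (half_pos hε).le _ ?_) (half_lt_self hε)
  refine Eventually.of_forall fun x => ?_
  have := h (a := (s, x)) (b := (t, x)) (by simpa [Prod.dist_eq] using hs)
  rw [dist_eq_norm] at this
  exact this.le

end Slice

section Pairing
variable {T : ℝ} {Ω : Set Plane}

/-- The pairing `∫₀ᵀ∫_Ω u z` of `L²(L¹)` with `L²(L^∞)`. -/
noncomputable def spaceTimePairing (T : ℝ) (Ω : Set Plane) :
    L2L1 T Ω →L[ℝ] Lp (Lp ℝ ⊤ (spaceMeasure Ω)) 2 (timeMeasure T) →L[ℝ] ℝ :=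
  ContinuousLinearMap.lpPairing (timeMeasure T) 2 2
    (ContinuousLinearMap.lpPairing (spaceMeasure Ω) 1 ⊤ (ContinuousLinearMap.mul ℝ ℝ))

lemma spaceTimePairing_apply (u : L2L1 T Ω) (z : Lp (Lp ℝ ⊤ (spaceMeasure Ω)) 2 (timeMeasure T)) :
    spaceTimePairing T Ω u z = ∫ t in Icc 0 T, ∫ x in Ω, u t x * z t x := by
  rw [spaceTimePairing, ContinuousLinearMap.lpPairing_eq_integral]
  refine integral_congr_ae (Eventually.of_forall fun t => ?_)
  exact ContinuousLinearMap.lpPairing_eq_integral _ _ _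

/-- The spatial gradient of a function on space-time. -/
noncomputable def spaceGrad (φ : ℝ × Plane → ℝ) (p : ℝ × Plane) : Plane :=
  (InnerProductSpace.toDual ℝ Plane).symm
    ((fderiv ℝ φ p).comp (ContinuousLinearMap.inr ℝ ℝ Plane))

lemma inner_spaceGrad (φ : ℝ × Plane → ℝ) (p : ℝ × Plane) (y : Plane) :
    innerSL ℝ (spaceGrad φ p) y = fderiv ℝ φ p (0, y) := by
  rw [innerSL_apply_apply, spaceGrad, InnerProductSpace.toDual_symm_apply]
  rfl

lemma continuous_spaceGrad {φ : ℝ × Plane → ℝ} (hφ : ContDiff ℝ ∞ φ) :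
    Continuous (spaceGrad φ) :=
  (LinearIsometryEquiv.continuous _).comp
    ((hφ.continuous_fderiv (by simp)).clm_comp continuous_const)

lemma hasCompactSupport_spaceGrad {φ : ℝ × Plane → ℝ} (hc : HasCompactSupport φ) :
    HasCompactSupport (spaceGrad φ) :=
  (hc.fderiv (𝕜 := ℝ)).comp_left
    (g := fun l : ℝ × Plane →L[ℝ] ℝ => (InnerProductSpace.toDual ℝ Plane).symm
      (l.comp (ContinuousLinearMap.inr ℝ ℝ Plane))) (by simp)

/-- Multiplication of a Bochner function by a bounded continuous one through a bilinear map. -/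
lemma exists_Lp_bilin {X Y Z : Type*} [NormedAddCommGroup X] [NormedSpace ℝ X]
    [NormedAddCommGroup Y] [NormedSpace ℝ Y] [NormedAddCommGroup Z] [NormedSpace ℝ Z]
    {p : ℝ≥0∞} {μ : Measure ℝ} (B : X →L[ℝ] Y →L[ℝ] Z) {k : ℝ → X} (hk : Continuous k) {C : ℝ}
    (hC : ∀ t, ‖k t‖ ≤ C) (f : Lp Y p μ) :
    ∃ z : Lp Z p μ, (∀ᵐ t ∂μ, z t = B (k t) (f t)) ∧ ‖z‖ ≤ ‖B‖ * C * ‖f‖ := by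
  have hm : AEStronglyMeasurable (fun t => B (k t) (f t)) μ :=
    B.aestronglyMeasurable_comp₂ hk.aestronglyMeasurable (Lp.aestronglyMeasurable f)
  have hbd : ∀ t, ‖B (k t) (f t)‖ ≤ ‖B‖ * C * ‖f t‖ := fun t =>
    (B.le_opNorm₂ _ _).trans (by gcongr; exact hC t)
  have hL := (Lp.memLp f).of_le_mul hm (Eventually.of_forall hbd)
  refine ⟨hL.toLp _, hL.coeFn_toLp, Lp.norm_le_mul_norm_of_ae_le_mul ?_⟩
  filter_upwards [hL.coeFn_toLp] with t ht
  rw [ht]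
  exact hbd t

/-- The Bochner function `t ↦ ∂ₜφ(t, ·)`. -/
lemma exists_Lp_timeDeriv (T : ℝ) (Ω : Set Plane) {φ : ℝ × Plane → ℝ} (hφ : ContDiff ℝ ∞ φ)
    (hc : HasCompactSupport φ) :
    ∃ z : Lp (Lp ℝ ⊤ (spaceMeasure Ω)) 2 (timeMeasure T), ∀ᵐ t ∂(timeMeasure T),
      ∀ᵐ x ∂(spaceMeasure Ω), z t x = fderiv ℝ φ (t, x) (1, 0) := by
  have hk : Continuous fun p => fderiv ℝ φ p (1, 0) :=
    (hφ.continuous_fderiv (by simp)).clm_apply continuous_const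
  have hkc : HasCompactSupport fun p => fderiv ℝ φ p (1, 0) := hc.fderiv_apply (𝕜 := ℝ) _
  obtain ⟨C, hC⟩ := hk.bounded_above_of_compact_support hkc
  have hm : MemLp (sliceLp hk hkc (spaceMeasure Ω)) 2 (timeMeasure T) :=
    MemLp.of_bound (continuous_sliceLp hk hkc _).aestronglyMeasurable C
      (Eventually.of_forall fun t => norm_sliceLp_le hk hkc _ hC t)
  refine ⟨hm.toLp _, ?_⟩
  filter_upwards [hm.coeFn_toLp] with t ht
  rw [ht]
  exact coeFn_sliceLp hk hkc _ t

set_option maxHeartbeats 1000000 in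
/-- The Bochner function `t ↦ b(t)·∇φ(t, ·)`, bounded in terms of `b` by the Sobolev
embedding. -/
lemma exists_Lp_advection (hfin : volume Ω ≠ ⊤) {φ : ℝ × Plane → ℝ} (hφ : ContDiff ℝ ∞ φ)
    (hc : HasCompactSupport φ) :
    ∃ C : ℝ, ∀ b : L2H3 T Ω, MemL2H30div b →
      ∃ z : Lp (Lp ℝ ⊤ (spaceMeasure Ω)) 2 (timeMeasure T), (∀ᵐ t ∂(timeMeasure T),
        ∀ᵐ x ∂(spaceMeasure Ω), z t x = fderiv ℝ φ (t, x) (0, H3.val (b t) x)) ∧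
        ‖z‖ ≤ C * ‖b‖ := by
  have hk := continuous_spaceGrad hφ
  have hkc := hasCompactSupport_spaceGrad hc
  obtain ⟨C, hC⟩ := hk.bounded_above_of_compact_support hkc
  let B := ((innerSL ℝ : Plane →L[ℝ] Plane →L[ℝ] ℝ).holderL (spaceMeasure Ω) ⊤ ⊤ ⊤)
  let B' := (B.flip.comp (supEmbedding hfin)).flip
  refine ⟨‖B'‖ * C, fun b hb => ?_⟩
  obtain ⟨b', hb', hnorm⟩ := hb.exists_lift
  obtain ⟨z, hz, hzn⟩ := exists_Lp_bilin B' (continuous_sliceLp hk hkc (spaceMeasure Ω))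
    (norm_sliceLp_le hk hkc (spaceMeasure Ω) hC) b'
  refine ⟨z, ?_, hnorm ▸ hzn⟩
  filter_upwards [hz, hb'] with t ht ht2
  rw [ht, ← ht2]
  filter_upwards [ContinuousLinearMap.coeFn_holder (r := ⊤) (innerSL ℝ : Plane →L[ℝ] Plane →L[ℝ] ℝ)
    (sliceLp hk hkc (spaceMeasure Ω) t) (supEmbedding hfin (b' t)),
    coeFn_sliceLp hk hkc (spaceMeasure Ω) t, coeFn_supEmbedding hfin (b' t)] with x h1 h2 h3
  refine h1.trans ?_
  rw [h2, h3, inner_spaceGrad]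

set_option maxHeartbeats 1000000 in
/-- For `w ∈ L²(L²)`, the functional `b ↦ ∫₀ᵀ∫_Ω w b·∇φ` on `L²(H³)` is continuous. -/
lemma exists_dual_advection (w : L2L2 T Ω) {φ : ℝ × Plane → ℝ} (hφ : ContDiff ℝ ∞ φ)
    (hc : HasCompactSupport φ) :
    ∃ l : L2H3 T Ω →L[ℝ] ℝ, ∀ b, l b = ∫ t in Icc 0 T, ∫ x in Ω,
      w t x * fderiv ℝ φ (t, x) (0, H3.val (b t) x) := by
  have hk := continuous_spaceGrad hφ
  have hkc := hasCompactSupport_spaceGrad hc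
  obtain ⟨C, hC⟩ := hk.bounded_above_of_compact_support hkc
  let M : ℝ →L[ℝ] Plane →L[ℝ] Plane := ContinuousLinearMap.lsmul ℝ ℝ
  obtain ⟨f, hf, -⟩ := exists_Lp_bilin (M.holderL (spaceMeasure Ω) 2 ⊤ 2).flip
    (continuous_sliceLp hk hkc (spaceMeasure Ω)) (norm_sliceLp_le hk hkc (spaceMeasure Ω) hC) w
  let D₀ := ContinuousLinearMap.lpPairing (spaceMeasure Ω) 2 2
    (innerSL ℝ : Plane →L[ℝ] Plane →L[ℝ] ℝ)
  let D : Lp Plane 2 (spaceMeasure Ω) →L[ℝ] H3 Ω →L[ℝ] ℝ :=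
    (D₀.flip.comp (derivCLM Ω MultiIdx.zero)).flip
  refine ⟨ContinuousLinearMap.lpPairing (timeMeasure T) 2 2 D f, fun b => ?_⟩
  rw [ContinuousLinearMap.lpPairing_eq_integral]
  refine integral_congr_ae ?_
  filter_upwards [hf] with t ht
  rw [ht]
  refine (ContinuousLinearMap.lpPairing_eq_integral _ _ (H3.val (b t))).trans ?_
  refine integral_congr_ae ?_
  filter_upwards [ContinuousLinearMap.coeFn_holder (r := 2) M (w t)
    (sliceLp hk hkc (spaceMeasure Ω) t), coeFn_sliceLp hk hkc (spaceMeasure Ω) t] with x h1 h2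
  have h3 : M.holder 2 (w t) (sliceLp hk hkc (spaceMeasure Ω) t) x
      = w t x • spaceGrad φ (t, x) := by rw [← h2]; exact h1
  refine (congrArg (fun v => innerSL ℝ v (H3.val (b t) x)) h3).trans ?_
  rw [map_smul, _root_.smul_apply, inner_spaceGrad, smul_eq_mul]

/-- The left-hand side of the weak formulation as a pairing of `u` with an element of
`L²(L^∞)`. -/
lemma exists_pairing_eq (hfin : volume Ω ≠ ⊤) {φ : ℝ × Plane → ℝ} (hφ : ContDiff ℝ ∞ φ)
    (hc : HasCompactSupport φ) {b : L2H3 T Ω} (hb : MemL2H30div b) :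
    ∃ z : Lp (Lp ℝ ⊤ (spaceMeasure Ω)) 2 (timeMeasure T), (∀ᵐ t ∂(timeMeasure T),
        ∀ᵐ x ∂(spaceMeasure Ω), z t x
          = fderiv ℝ φ (t, x) (1, 0) + fderiv ℝ φ (t, x) (0, H3.val (b t) x)) := by
  obtain ⟨z₀, hz₀⟩ := exists_Lp_timeDeriv T Ω hφ hc
  obtain ⟨_, h⟩ := exists_Lp_advection (T := T) hfin hφ hc
  obtain ⟨z₁, hz₁, -⟩ := h b hb
  refine ⟨z₀ + z₁, ?_⟩
  filter_upwards [hz₀, hz₁, Lp.coeFn_add z₀ z₁] with t h0 h1 h2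
  rw [h2]
  filter_upwards [h0, h1, Lp.coeFn_add (z₀ t) (z₁ t)] with x g0 g1 g2
  rw [Pi.add_apply, g2, Pi.add_apply, g0, g1]

lemma spaceTimePairing_congr (u : L2L1 T Ω) {z : Lp (Lp ℝ ⊤ (spaceMeasure Ω)) 2 (timeMeasure T)}
    {f : ℝ → Plane → ℝ}
    (h : ∀ᵐ t ∂(timeMeasure T), ∀ᵐ x ∂(spaceMeasure Ω), z t x = f t x) :
    spaceTimePairing T Ω u z = ∫ t in Icc 0 T, ∫ x in Ω, u t x * f t x := by
  rw [spaceTimePairing_apply]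
  refine integral_congr_ae ?_
  filter_upwards [h] with t ht
  refine integral_congr_ae ?_
  filter_upwards [ht] with x hx
  rw [hx]

set_option maxHeartbeats 1000000 in
/-- Weak solutions pass to the limit: the product `uₙ bₙ` of a strongly convergent and a bounded
weakly convergent factor converges when tested with `∇φ`. -/
lemma IsWeakSolution.of_tendsto (hfin : volume Ω ≠ ⊤) {u₀ : Lp ℝ 1 (spaceMeasure Ω)}
    {b : L2H3 T Ω} {bn : ℕ → L2H3 T Ω} (hbn : ∀ n, MemL2H30div (bn n))
    (hbdd : ∃ C : ℝ, ∀ n, ‖bn n‖ ≤ C) (hw : WeaklyConverges bn b)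
    {un : ℕ → L2L1 T Ω} {u : L2L1 T Ω} (hun : ∀ n, IsWeakSolution u₀ (bn n) (un n))
    (hlim : Tendsto un atTop (𝓝 u)) (hu : MemL2L2 u) : IsWeakSolution u₀ b u := by
  intro φ hφ
  have hb : MemL2H30div b := MemL2H30div.of_weaklyConverges hbn hw
  obtain ⟨w, hwu⟩ := hu
  obtain ⟨C, hC⟩ := hbdd
  obtain ⟨z₀, hz₀⟩ := exists_Lp_timeDeriv T Ω hφ.1 hφ.2.1
  obtain ⟨K, hK⟩ := exists_Lp_advection (T := T) hfin hφ.1 hφ.2.1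
  obtain ⟨l, hl⟩ := exists_dual_advection w hφ.1 hφ.2.1
  set P := spaceTimePairing T Ω
  have hsum : ∀ (c : L2H3 T Ω) (z₁ : Lp (Lp ℝ ⊤ (spaceMeasure Ω)) 2 (timeMeasure T)),
      (∀ᵐ t ∂(timeMeasure T), ∀ᵐ x ∂(spaceMeasure Ω),
        z₁ t x = fderiv ℝ φ (t, x) (0, H3.val (c t) x)) → ∀ v : L2L1 T Ω,
      P v (z₀ + z₁) = ∫ t in Icc 0 T, ∫ x in Ω,
        v t x * (fderiv ℝ φ (t, x) (1, 0) + fderiv ℝ φ (t, x) (0, H3.val (c t) x)) := by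
    intro c z₁ hz₁ v
    apply spaceTimePairing_congr
    filter_upwards [hz₀, hz₁, Lp.coeFn_add z₀ z₁] with t h0 h1 h2
    rw [h2]
    filter_upwards [h0, h1, Lp.coeFn_add (z₀ t) (z₁ t)] with x g0 g1 g2
    rw [Pi.add_apply, g2, Pi.add_apply, g0, g1]
  have hdual : ∀ (c : L2H3 T Ω) (z₁ : Lp (Lp ℝ ⊤ (spaceMeasure Ω)) 2 (timeMeasure T)),
      (∀ᵐ t ∂(timeMeasure T), ∀ᵐ x ∂(spaceMeasure Ω),
        z₁ t x = fderiv ℝ φ (t, x) (0, H3.val (c t) x)) → P u z₁ = l c := by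
    intro c z₁ hz₁
    rw [hl, spaceTimePairing_congr u hz₁]
    refine integral_congr_ae ?_
    filter_upwards [hwu] with t ht
    refine integral_congr_ae ?_
    filter_upwards [ht] with x hx
    rw [hx]
  choose z hz hzn using fun n => hK (bn n) (hbn n)
  obtain ⟨z', hz', -⟩ := hK b hb
  rw [← hsum b z' hz' u]
  have hconst : ∀ n, P (un n) (z₀ + z n) = - ∫ x in Ω, u₀ x * φ (0, x) := fun n => by
    rw [hsum (bn n) (z n) (hz n), hun n φ hφ]
  -- strong convergence of `un`, with the `z n` bounded
  have h1 : Tendsto (fun n => P (un n - u) (z₀ + z n)) atTop (𝓝 0) := by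
    have hb0 : Tendsto (fun n => ‖P‖ * ‖un n - u‖ * (‖z₀‖ + |K| * C)) atTop (𝓝 0) := by
      have : Tendsto (fun n => ‖un n - u‖) atTop (𝓝 0) := tendsto_iff_norm_sub_tendsto_zero.1 hlim
      simpa using (this.const_mul ‖P‖).mul_const (‖z₀‖ + |K| * C)
    refine squeeze_zero_norm (fun n => ?_) hb0
    refine (P.le_opNorm₂ _ _).trans ?_
    gcongr
    refine (norm_add_le _ _).trans ?_
    gcongr
    refine (hzn n).trans ?_
    calc K * ‖bn n‖ ≤ |K| * ‖bn n‖ := by gcongr; exact le_abs_self K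
      _ ≤ _ := by gcongr; exact hC n
  -- weak convergence of `bn`, through the functional `l`, which needs `u` in `L²(L²)`
  have h2 : Tendsto (fun n => P u (z₀ + z n)) atTop (𝓝 (P u (z₀ + z'))) := by
    have e : ∀ n, P u (z₀ + z n) = P u z₀ + l (bn n) := fun n => by
      rw [map_add, hdual _ _ (hz n)]
    simp only [e]
    rw [map_add, hdual _ _ hz']
    exact (hw l).const_add _
  have h3 : Tendsto (fun n => P (un n) (z₀ + z n)) atTop (𝓝 (0 + P u (z₀ + z'))) := by
    refine (h1.add h2).congr fun n => ?_
    rw [map_sub, _root_.sub_apply]; ring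
  simp only [hconst] at h3
  have := tendsto_nhds_unique h3 tendsto_const_nhds
  rw [← this, zero_add]

end Pairing

/-! ### Approximation of Bochner fields by ordered time pulses of test fields -/

/-- A smooth pulse in time, supported in `(a, b)` and equal to `1` except near the endpoints. -/
lemma exists_pulse {a b κ : ℝ} (hab : a < b) (hκ0 : 0 < κ) (hκ1 : κ < 1) :
    ∃ θ : ℝ → ℝ, ContDiff ℝ ∞ θ ∧ (∀ t, 0 ≤ θ t) ∧ (∀ t, θ t ≤ 1) ∧ (∀ t, t ∉ Ioo a b → θ t = 0) ∧
      ∀ t, a + κ * (b - a) / 2 ≤ t → t ≤ b - κ * (b - a) / 2 → θ t = 1 := by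
  have hpos : 0 < b - a := sub_pos.2 hab
  let f : ContDiffBump ((a + b) / 2) :=
    ⟨(1 - κ) * (b - a) / 2, (b - a) / 2,
      by have := mul_pos (sub_pos.2 hκ1) hpos; linarith, by nlinarith⟩
  refine ⟨f, f.contDiff, fun t => f.nonneg, fun t => f.le_one, fun t ht => ?_, fun t h1 h2 => ?_⟩
  · apply f.zero_of_le_dist
    change (b - a) / 2 ≤ _
    by_contra h
    rw [not_le, Real.dist_eq, abs_lt] at h
    exact ht ⟨by linarith, by linarith⟩
  · apply f.one_of_mem_closedBall
    rw [Metric.mem_closedBall, Real.dist_eq, abs_le]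
    change -((1 - κ) * (b - a) / 2) ≤ _ ∧ _ ≤ (1 - κ) * (b - a) / 2
    constructor <;> linarith

lemma integral_pulse_le {a b : ℝ} (hab : a ≤ b) {θ : ℝ → ℝ} (hθ0 : ∀ t, 0 ≤ θ t)
    (hθ1 : ∀ t, θ t ≤ 1) (hθs : ∀ t, t ∉ Ioo a b → θ t = 0) : ∫ t, θ t ≤ b - a := by
  rw [← setIntegral_eq_integral_of_forall_compl_eq_zero hθs]
  have := norm_setIntegral_le_of_norm_le_const (μ := volume) (s := Ioo a b) (f := θ) (C := 1)
    (by simp) (fun t _ => by rw [Real.norm_of_nonneg (hθ0 t)]; exact hθ1 t)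
  rw [one_mul, Real.volume_real_Ioo_of_le hab] at this
  exact (le_abs_self _).trans this

lemma H30Space.exists_test_near {Ω : Set Plane} (f : H30Space Ω) {δ : ℝ} (hδ : 0 < δ) :
    ∃ (G : H30Space Ω) (g : Plane → Plane), IsJetOf (incl Ω G) g ∧ ‖f - G‖ ≤ δ := by
  obtain ⟨f', ⟨g, hg⟩, hd⟩ := Metric.mem_closure_iff.1 f.incl_mem δ hδ
  obtain ⟨G, rfl⟩ := exists_incl_eq (f := f') (subset_closure ⟨g, hg⟩)
  refine ⟨G, g, hg, ?_⟩
  rw [dist_eq_norm, ← map_sub, LinearIsometry.norm_map] at hd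
  exact hd.le

/-- An `L²` field is close to a sum of consecutive smooth time pulses of elements of a dense set.
The mass of each pulse times the square of its size is at most `ε`, which makes the residual of the
backward scheme small; at most one pulse is active at a time, so that the norm of the sum is the
sum of the norms. -/
lemma exists_pulse_approx {V : Type*} [NormedAddCommGroup V] [NormedSpace ℝ V] {P : V → Prop}
    (hP : ∀ f : V, ∀ δ > 0, ∃ G, P G ∧ ‖f - G‖ ≤ δ) {τ : ℝ} (hτ : 0 < τ) {b : ℝ → V}
    (hb : MemLp b 2 (volume.restrict (Icc 0 τ))) {ε : ℝ} (hε : 0 < ε) :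
    ∃ (n : ℕ) (s : ℕ → ℝ) (θ : ℕ → ℝ → ℝ) (G : ℕ → V), Antitone s ∧ s 0 = τ ∧ s n = 0 ∧
      (∀ j, ContDiff ℝ ∞ (θ j)) ∧ (∀ j t, 0 ≤ θ j t) ∧ (∀ j t, θ j t ≤ 1) ∧
      (∀ j t, t ∉ Ioo (s (j + 1)) (s j) → θ j t = 0) ∧ (∀ j, P (G j)) ∧
      (∀ j, (∫ t, θ j t) * ‖G j‖ ^ 2 ≤ ε) ∧
      (∀ t, ∑ j ∈ Finset.range n, θ j t * ‖G j‖ ≤ ‖∑ j ∈ Finset.range n, θ j t • G j‖) ∧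
      eLpNorm (fun t => b t - ∑ j ∈ Finset.range n, θ j t • G j) 2 (volume.restrict (Icc 0 τ))
        ≤ ENNReal.ofReal ε := by
  set δ : ℝ := min 1 (ε / (3 * (1 + 2 * √τ))) with hδdef
  have hδ : 0 < δ := by positivity
  have hδ1 : δ ≤ 1 := min_le_left _ _
  have hδ2 : δ * (1 + 2 * √τ) ≤ ε / 3 := by
    have : δ ≤ ε / (3 * (1 + 2 * √τ)) := min_le_right _ _
    calc δ * (1 + 2 * √τ) ≤ ε / (3 * (1 + 2 * √τ)) * (1 + 2 * √τ) := by gcongr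
      _ = ε / 3 := by field_simp
  obtain ⟨B, hB, -⟩ := hb.exists_boundedContinuous_eLpNorm_sub_le (by simp)
    (ε := ENNReal.ofReal δ) (by simpa using hδ)
  set M : ℝ := ‖B‖ with hM
  have hM0 : 0 ≤ M := norm_nonneg _
  have hBM : ∀ t, ‖B t‖ ≤ M := B.norm_coe_le_norm
  -- the modulus of continuity of `B` on the compact interval fixes the mesh
  have huc : UniformContinuousOn B (Icc 0 τ) :=
    isCompact_Icc.uniformContinuousOn_of_continuous B.continuous.continuousOn
  obtain ⟨η, hη, hBη⟩ := Metric.uniformContinuousOn_iff.1 huc δ hδ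
  obtain ⟨n, hn⟩ := exists_nat_gt (max (τ / η) (τ * (M + 1) ^ 2 / ε))
  have hn0 : (0 : ℝ) < n := lt_of_le_of_lt (le_max_of_le_left (by positivity)) hn
  set h : ℝ := τ / n with hh
  have hhpos : 0 < h := by positivity
  have hnh : n * h = τ := by rw [hh]; field_simp
  have hhη : h < η := by
    rw [hh, div_lt_iff₀ hn0, mul_comm, ← div_lt_iff₀ hη]
    exact (le_max_left _ _).trans_lt hn
  have hhε : h * (M + 1) ^ 2 ≤ ε := by
    rw [hh, div_mul_eq_mul_div, div_le_iff₀ hn0, mul_comm ε, ← div_le_iff₀ hε]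
    exact ((le_max_right _ _).trans_lt hn).le
  -- the relative length of the ends of a pulse, where `B` is not approximated but only bounded
  set κ : ℝ := min (1 / 2) ((ε / (3 * (2 * M + 1))) ^ 2 / τ) with hκ
  have hκ0 : 0 < κ := by positivity
  have hκ1 : κ < 1 := lt_of_le_of_lt (min_le_left _ _) (by norm_num)
  have hκ2 : (2 * M + 1) * √(κ * τ) ≤ ε / 3 := by
    have h1 : κ * τ ≤ (ε / (3 * (2 * M + 1))) ^ 2 := by
      have : κ ≤ (ε / (3 * (2 * M + 1))) ^ 2 / τ := min_le_right _ _
      calc κ * τ ≤ (ε / (3 * (2 * M + 1))) ^ 2 / τ * τ := by gcongr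
        _ = _ := by field_simp
    have h2 : √(κ * τ) ≤ ε / (3 * (2 * M + 1)) := Real.sqrt_le_iff.2 ⟨by positivity, h1⟩
    calc _ ≤ (2 * M + 1) * (ε / (3 * (2 * M + 1))) := by gcongr
      _ = _ := by field_simp
  set s : ℕ → ℝ := fun j => τ - j * h with hs
  have hs1 : ∀ j, s (j + 1) = s j - h := fun j => by simp only [hs]; push_cast; ring
  have hanti : Antitone s := antitone_nat_of_succ_le fun j => by rw [hs1]; linarith
  have hs0 : s 0 = τ := by simp [hs]
  have hsn : s n = 0 := by simp only [hs]; rw [hnh]; ring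
  choose θ hθsm hθ0 hθ1 hθs hθone using fun j : ℕ =>
    exists_pulse (a := s (j + 1)) (b := s j) (κ := κ) (by rw [hs1]; linarith) hκ0 hκ1
  choose G hG hGB using fun j : ℕ => hP (B (s j)) δ hδ
  have hGM : ∀ j, ‖G j‖ ≤ M + 1 := fun j => by
    have : G j = B (s j) - (B (s j) - G j) := by abel
    rw [this]
    exact (norm_sub_le _ _).trans (add_le_add (hBM _) ((hGB j).trans hδ1))
  -- only one pulse is active at a time
  have hoff : ∀ t j, t ∈ Ioo (s (j + 1)) (s j) → ∀ i, i ≠ j → θ i t = 0 := by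
    intro t j ht i hij
    refine hθs i t fun ht' => ?_
    rcases lt_or_gt_of_ne hij with hlt | hlt
    · exact absurd (ht.2.trans_le (hanti (Nat.succ_le_of_lt hlt))) (not_lt.2 ht'.1.le)
    · exact absurd (ht'.2.trans_le (hanti (Nat.succ_le_of_lt hlt))) (not_lt.2 ht.1.le)
  have hsingle : ∀ t j, j ∈ Finset.range n → t ∈ Ioo (s (j + 1)) (s j) →
      ∑ i ∈ Finset.range n, θ i t • G i = θ j t • G j := fun t j hj ht =>
    Finset.sum_eq_single_of_mem j hj fun i _ hij => by rw [hoff t j ht i hij, zero_smul]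
  refine ⟨n, s, θ, G, hanti, hs0, hsn, hθsm, hθ0, hθ1, hθs, hG, fun j => ?_, fun t => ?_, ?_⟩
  · refine le_trans ?_ hhε
    gcongr
    · refine (integral_pulse_le (hanti j.le_succ) (hθ0 j) (hθ1 j) (hθs j)).trans ?_
      rw [Nat.succ_eq_add_one, hs1]; linarith
    · exact hGM j
  · by_cases hex : ∃ j ∈ Finset.range n, t ∈ Ioo (s (j + 1)) (s j)
    · obtain ⟨j, hj, hjt⟩ := hex
      rw [hsingle t j hj hjt, norm_smul, Real.norm_of_nonneg (hθ0 j t)]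
      refine (Finset.sum_eq_single_of_mem j hj fun i hi hij => ?_).le
      rw [hoff t j hjt i hij, zero_mul]
    · push Not at hex
      rw [Finset.sum_eq_zero fun j hj => by rw [hθs j t (hex j hj), zero_mul]]
      exact norm_nonneg _
  -- the times at which some pulse is rising or falling
  set bad : Set ℝ := ⋃ j ∈ Finset.range n,
    (Icc (s (j + 1)) (s (j + 1) + κ * h / 2) ∪ Icc (s j - κ * h / 2) (s j)) with hbad
  have hbadm : MeasurableSet bad :=
    Finset.measurableSet_biUnion _ fun j _ => measurableSet_Icc.union measurableSet_Icc
  have hbadvol : volume bad ≤ ENNReal.ofReal (κ * τ) := by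
    calc volume bad ≤ ∑ j ∈ Finset.range n, volume
          (Icc (s (j + 1)) (s (j + 1) + κ * h / 2) ∪ Icc (s j - κ * h / 2) (s j)) :=
          measure_biUnion_finset_le _ _
      _ ≤ ∑ j ∈ Finset.range n, ENNReal.ofReal (κ * h) := by
          refine Finset.sum_le_sum fun j _ => (measure_union_le _ _).trans ?_
          rw [Real.volume_Icc, Real.volume_Icc, ← ENNReal.ofReal_add (by ring_nf; positivity)
            (by ring_nf; positivity)]
          apply le_of_eq; congr 1; ring
      _ = ENNReal.ofReal (κ * τ) := by
          rw [Finset.sum_const, Finset.card_range, nsmul_eq_mul, ← ENNReal.ofReal_natCast,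
            ← ENNReal.ofReal_mul (by positivity)]
          congr 1; rw [← hnh]; ring
  have hpt : ∀ᵐ t ∂(volume.restrict (Icc 0 τ)),
      ‖B t - ∑ j ∈ Finset.range n, θ j t • G j‖
        ≤ 2 * δ + bad.indicator (fun _ => 2 * M + 1) t := by
    have hne : ∀ᵐ t ∂(volume.restrict (Icc (0 : ℝ) τ)), t ≠ 0 :=
      ae_restrict_of_ae (Measure.ae_ne volume 0)
    filter_upwards [ae_restrict_mem measurableSet_Icc, hne] with t ht ht0
    have htpos : 0 < t := lt_of_le_of_ne ht.1 (Ne.symm ht0)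
    -- the index of the interval `(s (j + 1), s j]` that contains `t`
    set j : ℕ := ⌊(τ - t) / h⌋₊ with hj
    have hq0 : 0 ≤ (τ - t) / h := div_nonneg (sub_nonneg.2 ht.2) hhpos.le
    have hj1 : j * h ≤ τ - t := by
      rw [← le_div_iff₀ hhpos]; exact Nat.floor_le hq0
    have hj2 : τ - t < (j + 1) * h := by
      rw [← div_lt_iff₀ hhpos]; exact Nat.lt_floor_add_one _
    have hjn : j < n := by
      have : (j : ℝ) * h < n * h := by rw [hnh]; linarith
      exact_mod_cast lt_of_mul_lt_mul_right this hhpos.le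
    have hsj : t ≤ s j := by simp only [hs]; linarith
    have hsj1 : s (j + 1) < t := by rw [hs1]; simp only [hs]; linarith
    have hjr : j ∈ Finset.range n := Finset.mem_range.2 hjn
    have hsjmem : s j ∈ Icc 0 τ := ⟨hsn ▸ hanti hjn.le, hs0 ▸ hanti (Nat.zero_le j)⟩
    by_cases hgood : s (j + 1) + κ * h / 2 ≤ t ∧ t ≤ s j - κ * h / 2
    · have hκh : 0 < κ * h := by positivity
      have hb' : s j - s (j + 1) = h := by rw [hs1]; ring
      have hθ1' : θ j t = 1 := hθone j t (by rw [hb']; exact hgood.1) (by rw [hb']; exact hgood.2)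
      rw [hsingle t j hjr ⟨hsj1, by linarith [hgood.2]⟩, hθ1', one_smul]
      have hclose : ‖B t - B (s j)‖ ≤ δ := by
        rw [← dist_eq_norm]
        refine (hBη t ht (s j) hsjmem ?_).le
        rw [Real.dist_eq, abs_lt]
        rw [hs1] at hsj1
        constructor <;> linarith
      have hi : 0 ≤ bad.indicator (fun _ => 2 * M + 1) t :=
        indicator_nonneg (fun _ _ => by positivity) t
      calc ‖B t - G j‖ ≤ ‖B t - B (s j)‖ + ‖B (s j) - G j‖ := norm_sub_le_norm_sub_add_norm_sub _ _ _
        _ ≤ _ := by linarith [hGB j]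
    · have htb : t ∈ bad := by
        simp only [hbad, mem_iUnion]
        refine ⟨j, hjr, ?_⟩
        rw [not_and_or, not_le, not_le] at hgood
        rcases hgood with hg | hg
        · exact Or.inl ⟨hsj1.le, hg.le⟩
        · exact Or.inr ⟨hg.le, hsj⟩
      rw [indicator_of_mem htb]
      have hsum : ‖∑ i ∈ Finset.range n, θ i t • G i‖ ≤ M + 1 := by
        by_cases hlt : t < s j
        · rw [hsingle t j hjr ⟨hsj1, hlt⟩, norm_smul, Real.norm_of_nonneg (hθ0 j t)]
          calc _ ≤ 1 * (M + 1) := mul_le_mul (hθ1 j t) (hGM j) (norm_nonneg _) zero_le_one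
            _ = _ := one_mul _
        · have hts : t = s j := le_antisymm hsj (not_lt.1 hlt)
          have : ∑ i ∈ Finset.range n, θ i t • G i = 0 := by
            refine Finset.sum_eq_zero fun i _ => ?_
            rw [hθs i t, zero_smul]
            intro hi
            rcases le_or_gt j i with hji | hji
            · exact absurd (hi.2.trans_le (hanti hji)) (by rw [hts]; exact lt_irrefl _)
            · exact absurd (hi.1.trans_le' (hanti (Nat.succ_le_of_lt hji)))
                (by rw [hts]; exact lt_irrefl _)
          rw [this, norm_zero]; positivity
      calc _ ≤ ‖B t‖ + ‖∑ i ∈ Finset.range n, θ i t • G i‖ := norm_sub_le _ _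
        _ ≤ _ := by linarith [hBM t]
  have hBk : eLpNorm (fun t => B t - ∑ j ∈ Finset.range n, θ j t • G j) 2
      (volume.restrict (Icc 0 τ)) ≤ ENNReal.ofReal (2 * δ * √τ) + ENNReal.ofReal (ε / 3) := by
    refine (eLpNorm_mono_ae_real hpt).trans ?_
    refine (eLpNorm_add_le aestronglyMeasurable_const
      (aestronglyMeasurable_const.indicator hbadm) (by norm_num)).trans ?_
    have hsqrt : ∀ c : ℝ, 0 ≤ c → ENNReal.ofReal c ^ (1 / (2 : ℝ≥0∞).toReal) = ENNReal.ofReal √c := by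
      intro c hc
      rw [Real.sqrt_eq_rpow, ← ENNReal.ofReal_rpow_of_nonneg hc (by norm_num)]
      norm_num
    refine add_le_add ?_ ?_
    · rw [eLpNorm_const' _ (by norm_num) (by norm_num), Measure.restrict_apply_univ,
        Real.volume_Icc, sub_zero, hsqrt τ hτ.le, ENNReal.ofReal_mul (by positivity),
        Real.enorm_of_nonneg (by positivity)]
    · refine (eLpNorm_indicator_const_le _ _).trans ?_
      rw [Real.enorm_of_nonneg (by positivity)]
      refine le_trans ?_ (ENNReal.ofReal_le_ofReal hκ2)
      rw [ENNReal.ofReal_mul (by positivity), ← hsqrt _ (by positivity)]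
      gcongr
      exact (Measure.restrict_apply_le _ _).trans hbadvol
  have hsplit : (fun t => b t - ∑ j ∈ Finset.range n, θ j t • G j)
      = (b - B) + fun t => B t - ∑ j ∈ Finset.range n, θ j t • G j := by
    ext t; simp
  rw [hsplit]
  have hcont : Continuous fun t => B t - ∑ j ∈ Finset.range n, θ j t • G j :=
    B.continuous.sub (continuous_finsetSum _ fun j _ => (hθsm j).continuous.smul continuous_const)
  refine (eLpNorm_add_le (hb.1.sub B.continuous.aestronglyMeasurable) hcont.aestronglyMeasurable
    (by norm_num)).trans ((add_le_add hB hBk).trans ?_)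
  rw [← ENNReal.ofReal_add (by positivity) (by positivity),
    ← ENNReal.ofReal_add (by positivity) (by positivity)]
  apply ENNReal.ofReal_le_ofReal
  linarith

/-! ### The duality estimate -/

/-- The Cauchy-Schwarz inequality for the norms of vector-valued functions. -/
lemma integral_norm_mul_norm_le {X E F : Type*} [MeasurableSpace X] {μ : Measure X}
    [NormedAddCommGroup E] [NormedAddCommGroup F] {f : X → E} {g : X → F}
    (hf : MemLp f 2 μ) (hg : MemLp g 2 μ) :
    Integrable (fun x => ‖f x‖ * ‖g x‖) μ ∧
      ∫ x, ‖f x‖ * ‖g x‖ ∂μ ≤ (eLpNorm f 2 μ).toReal * (eLpNorm g 2 μ).toReal := by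
  have hi : Integrable (fun x => ‖f x‖ * ‖g x‖) μ := hf.norm.integrable_mul hg.norm
  refine ⟨hi, ?_⟩
  have h1 : ∫ x, ‖f x‖ * ‖g x‖ ∂μ = (eLpNorm (fun x => ‖f x‖ * ‖g x‖) 1 μ).toReal := by
    rw [eLpNorm_one_eq_lintegral_enorm, integral_eq_lintegral_of_nonneg_ae
      (Eventually.of_forall fun x => by positivity) hi.1]
    congr 1
    refine lintegral_congr fun x => ?_
    rw [Real.enorm_of_nonneg (by positivity)]
  rw [h1, ← ENNReal.toReal_mul]
  refine ENNReal.toReal_mono (ENNReal.mul_ne_top hf.2.ne hg.2.ne) ?_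
  have h2 := eLpNorm_smul_le_mul_eLpNorm (p := 2) (q := 2) (r := 1) (μ := μ)
    hg.norm.1 hf.norm.1
  rwa [eLpNorm_norm, eLpNorm_norm] at h2

/-- The backward primitive of a bump `ρ`, cut off at negative times. -/
lemma exists_time_cutoff {T τ τ' : ℝ} (hT : 0 < T) (hτ'T : τ' < T) {ρ : ℝ → ℝ}
    (hρ : ContDiff ℝ ∞ ρ) (hρ0 : ∀ t, 0 ≤ ρ t) (hρs : ∀ t, t ∉ Icc τ τ' → ρ t = 0) :
    ∃ c : ℝ → ℝ, ContDiff ℝ ∞ c ∧ HasCompactSupport c ∧ tsupport c ⊆ Iio T ∧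
      (∀ t ∈ Icc 0 T, HasDerivAt c (-ρ t) t ∧ 0 ≤ c t ∧ c t ≤ ∫ t, ρ t) ∧
      ∀ t, τ' ≤ t → c t = 0 := by
  have hρc := hρ.continuous
  have hρint : Integrable ρ := hρc.integrable_of_hasCompactSupport
    (HasCompactSupport.intro (isCompact_Icc (a := τ) (b := τ')) hρs)
  set R : ℝ → ℝ := fun t => ∫ u in t..τ', ρ u with hR
  have hRd : ∀ t, HasDerivAt R (-ρ t) t := fun t =>
    intervalIntegral.integral_hasDerivAt_left (hρc.intervalIntegrable _ _)
      (hρc.stronglyMeasurableAtFilter _ _) hρc.continuousAt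
  have hRsm : ContDiff ℝ ∞ R := by
    rw [contDiff_infty_iff_deriv]
    refine ⟨fun t => (hRd t).differentiableAt, ?_⟩
    rw [show deriv R = fun t => -ρ t from funext fun t => (hRd t).deriv]
    exact hρ.neg
  have hRz : ∀ t, τ' ≤ t → R t = 0 := by
    intro t ht
    apply intervalIntegral.integral_zero_ae
    refine Eventually.of_forall fun u hu => hρs u fun h' => ?_
    rw [uIoc_of_ge ht] at hu
    exact absurd h'.2 (not_le.2 hu.1)
  have hRb : ∀ t, 0 ≤ R t ∧ R t ≤ ∫ t, ρ t := by
    intro t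
    rcases le_total τ' t with ht | ht
    · rw [hRz t ht]; exact ⟨le_rfl, integral_nonneg hρ0⟩
    · rw [hR]; simp only [intervalIntegral.integral_of_le ht]
      exact ⟨integral_nonneg hρ0, setIntegral_le_integral hρint (Eventually.of_forall hρ0)⟩
  -- `R` is constant for times before `τ`; multiply by a bump that is `1` on `[0, T]`
  let χ : ContDiffBump (0 : ℝ) := ⟨T + 1, T + 2, by linarith, by linarith⟩
  have hzero : ∀ t, t ∉ Icc (-(T + 2)) τ' → χ t * R t = 0 := by
    intro t ht
    rw [mem_Icc, not_and_or, not_le, not_le] at ht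
    rcases ht with ht | ht
    · rw [χ.zero_of_le_dist, zero_mul]
      rw [Real.dist_eq, sub_zero]
      change T + 2 ≤ |t|
      rw [abs_of_neg (by linarith)]; linarith
    · rw [hRz t ht.le, mul_zero]
  refine ⟨fun t => χ t * R t, χ.contDiff.mul hRsm, HasCompactSupport.intro isCompact_Icc hzero,
    ?_, fun t ht => ?_, fun t ht => by simp only [hRz t ht, mul_zero]⟩
  · have : tsupport (fun t => χ t * R t) ⊆ Icc (-(T + 2)) τ' :=
      closure_minimal (fun t ht => by_contra fun h => ht (hzero t h)) isClosed_Icc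
    exact this.trans fun t ht => ht.2.trans_lt hτ'T
  · have hmem : t ∈ Metric.ball (0 : ℝ) χ.rIn := by
      rw [Metric.mem_ball, Real.dist_eq, sub_zero, abs_of_nonneg ht.1]
      change t < T + 1
      linarith [ht.2]
    have hone : χ t = 1 := χ.one_of_mem_closedBall (Metric.ball_subset_closedBall hmem)
    have hev : (fun t => χ t * R t) =ᶠ[𝓝 t] R := by
      filter_upwards [Metric.isOpen_ball.mem_nhds hmem] with y hy
      rw [χ.one_of_mem_closedBall (Metric.ball_subset_closedBall hy), one_mul]
    refine ⟨(hRd t).congr_of_eventuallyEq hev, ?_⟩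
    simp only [hone, one_mul]
    exact hRb t

/-- The error, at a fixed time, of an approximate backward solution as a test function. -/
lemma ApproxBackward.abs_integral_le {Ω : Set Plane} {ζ : Plane → ℝ} {τ r s A : ℝ}
    {β : ℝ → Plane → Plane} {φ : ℝ × Plane → ℝ} (h : ApproxBackward Ω ζ τ r s A β φ)
    (hA : 0 ≤ A) {c : ℝ → ℝ} {t ρ m D : ℝ} (hc : HasDerivAt c (-ρ) t) (hc0 : 0 ≤ c t)
    (hcm : c t ≤ m) (hρ : t < τ → ρ = 0) (V : Lp ℝ 1 (spaceMeasure Ω)) {w : Plane → Plane}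
    (hζ : Integrable (fun x => V x * ζ x) (spaceMeasure Ω))
    (hint : Integrable (fun x => V x * (fderiv ℝ (fun p : ℝ × Plane => c p.1 * φ p) (t, x) (1, 0)
      + fderiv ℝ (fun p : ℝ × Plane => c p.1 * φ p) (t, x) (0, w x))) (spaceMeasure Ω))
    (hw : ∀ᵐ x ∂(spaceMeasure Ω), ‖w x - β t x‖ ≤ D) :
    |(∫ x in Ω, V x * (fderiv ℝ (fun p : ℝ × Plane => c p.1 * φ p) (t, x) (1, 0)
      + fderiv ℝ (fun p : ℝ × Plane => c p.1 * φ p) (t, x) (0, w x)))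
      + ρ * ∫ x in Ω, V x * ζ x| ≤ m * (A * (r * ‖V‖ + ‖V‖ * D)) := by
  have hd : ∀ x a y, fderiv ℝ (fun p : ℝ × Plane => c p.1 * φ p) (t, x) (a, y)
      = -(ρ * a) * φ (t, x) + c t * fderiv ℝ φ (t, x) (a, y) := by
    intro x a y
    have h1 : HasFDerivAt (fun p : ℝ × Plane => c p.1)
        ((ContinuousLinearMap.toSpanSingleton ℝ (-ρ)).comp (ContinuousLinearMap.fst ℝ ℝ Plane))
        (t, x) :=
      HasFDerivAt.comp (t, x) (f := Prod.fst) (g := c) hc.hasFDerivAt hasFDerivAt_fst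
    have h2 := ((h.smooth.differentiable (by simp)) (t, x)).hasFDerivAt
    have h3 : fderiv ℝ (fun p : ℝ × Plane => c p.1 * φ p) (t, x) = _ := (h1.mul h2).fderiv
    rw [h3]
    simp
    ring
  have hρζ : ∀ x, ρ * φ (t, x) = ρ * ζ x := fun x => by
    rcases lt_or_ge t τ with ht | ht
    · rw [hρ ht, zero_mul, zero_mul]
    · rw [h.terminal t x ht]
  have hm : 0 ≤ m := hc0.trans hcm
  rw [← integral_const_mul, ← integral_add hint (hζ.const_mul ρ)]
  have hbound : ∀ᵐ x ∂(spaceMeasure Ω),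
      ‖V x * (fderiv ℝ (fun p : ℝ × Plane => c p.1 * φ p) (t, x) (1, 0)
        + fderiv ℝ (fun p : ℝ × Plane => c p.1 * φ p) (t, x) (0, w x)) + ρ * (V x * ζ x)‖
        ≤ m * (A * (r + D)) * ‖V x‖ := by
    filter_upwards [hw] with x hx
    have hlin : fderiv ℝ φ (t, x) (1, 0) + fderiv ℝ φ (t, x) (0, w x)
        = fderiv ℝ φ (t, x) (1, β t x) + fderiv ℝ φ (t, x) (0, w x - β t x) := by
      rw [← map_add, ← map_add]; simp
    have e : V x * (fderiv ℝ (fun p : ℝ × Plane => c p.1 * φ p) (t, x) (1, 0)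
        + fderiv ℝ (fun p : ℝ × Plane => c p.1 * φ p) (t, x) (0, w x)) + ρ * (V x * ζ x)
        = c t * (fderiv ℝ φ (t, x) (1, β t x) + fderiv ℝ φ (t, x) (0, w x - β t x)) * V x := by
      rw [hd, hd, ← hlin]
      linear_combination (-V x) * hρζ x
    rw [e, norm_mul, norm_mul, Real.norm_of_nonneg hc0]
    gcongr
    calc _ ≤ A * r + A * ‖w x - β t x‖ :=
          (norm_add_le _ _).trans (add_le_add (h.residual t x) (h.grad _ _))
      _ ≤ A * r + A * D := by gcongr
      _ = _ := by ring
  have := norm_integral_le_of_norm_le ((L1.integrable_coeFn V).norm.const_mul _) hbound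
  rw [integral_const_mul, ← L1.norm_eq_integral_norm] at this
  calc _ ≤ _ := this
    _ = _ := by ring

lemma ApproxBackward.isSpaceTimeTest {Ω : Set Plane} {ζ : Plane → ℝ} {T τ r s A : ℝ}
    {β : ℝ → Plane → Plane} {φ : ℝ × Plane → ℝ} (h : ApproxBackward Ω ζ τ r s A β φ)
    {c : ℝ → ℝ} (hc : ContDiff ℝ ∞ c) (hcc : HasCompactSupport c) (hcs : tsupport c ⊆ Iio T) :
    IsSpaceTimeTest T Ω (fun p => c p.1 * φ p) := by
  obtain ⟨K, hK, hKΩ, hK0⟩ := h.supp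
  have hzero : ∀ p : ℝ × Plane, p ∉ tsupport c ×ˢ K → c p.1 * φ p = 0 := by
    rintro ⟨t, x⟩ hp
    rw [mem_prod, not_and_or] at hp
    rcases hp with hp | hp
    · rw [image_eq_zero_of_notMem_tsupport hp, zero_mul]
    · rw [hK0 t x hp, mul_zero]
  refine ⟨(hc.comp contDiff_fst).mul h.smooth, HasCompactSupport.intro (hcc.prod hK) hzero, ?_⟩
  have : tsupport (fun p : ℝ × Plane => c p.1 * φ p) ⊆ tsupport c ×ˢ K :=
    closure_minimal (fun p hp => by_contra fun h => hp (hzero p h))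
      ((isClosed_tsupport c).prod hK.isClosed)
  exact this.trans (prod_mono hcs hKΩ)

/-- A sum of smooth time pulses has total mass bounded by its `L¹`, hence its `L²`, norm. -/
lemma sum_integral_mul_norm_le {V : Type*} [NormedAddCommGroup V] [NormedSpace ℝ V] {τ : ℝ}
    (hτ : 0 ≤ τ) {n : ℕ} {θ : ℕ → ℝ → ℝ} {G : ℕ → V} (hθ : ∀ j, Continuous (θ j))
    (hθs : ∀ j ∈ Finset.range n, ∀ t, t ∉ Icc 0 τ → θ j t = 0)
    (hle : ∀ t, ∑ j ∈ Finset.range n, θ j t * ‖G j‖ ≤ ‖∑ j ∈ Finset.range n, θ j t • G j‖) :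
    ∑ j ∈ Finset.range n, (∫ t, θ j t) * ‖G j‖ ≤ √τ *
      (eLpNorm (fun t => ∑ j ∈ Finset.range n, θ j t • G j) 2 (volume.restrict (Icc 0 τ))).toReal := by
  have hcont : Continuous fun t => ∑ j ∈ Finset.range n, θ j t • G j :=
    continuous_finsetSum _ fun j _ => (hθ j).smul continuous_const
  have hmem : MemLp (fun t => ∑ j ∈ Finset.range n, θ j t • G j) 2 (volume.restrict (Icc 0 τ)) := by
    obtain ⟨C, hC⟩ := isCompact_Icc.exists_bound_of_continuousOn (hcont.continuousOn (s := Icc 0 τ))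
    exact MemLp.of_bound hcont.aestronglyMeasurable C
      ((ae_restrict_mem measurableSet_Icc).mono hC)
  have h1 : ∑ j ∈ Finset.range n, (∫ t, θ j t) * ‖G j‖
      = ∫ t in Icc 0 τ, ∑ j ∈ Finset.range n, θ j t * ‖G j‖ := by
    rw [integral_finsetSum (f := fun j t => θ j t * ‖G j‖) _ fun j _ =>
      (Continuous.integrableOn_Icc ((hθ j).mul continuous_const))]
    refine Finset.sum_congr rfl fun j hj => ?_
    rw [integral_mul_const, setIntegral_eq_integral_of_forall_compl_eq_zero (hθs j hj)]
  obtain ⟨hi, hCS⟩ := integral_norm_mul_norm_le (memLp_const (1 : ℝ)) hmem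
  have h2 : ∫ t in Icc 0 τ, ∑ j ∈ Finset.range n, θ j t * ‖G j‖
      ≤ ∫ t in Icc 0 τ, ‖(1 : ℝ)‖ * ‖∑ j ∈ Finset.range n, θ j t • G j‖ := by
    refine integral_mono ?_ hi fun t => by simpa using hle t
    exact (Continuous.integrableOn_Icc
      (continuous_finsetSum _ fun j _ => (hθ j).mul continuous_const))
  have h3 : (eLpNorm (fun _ : ℝ => (1 : ℝ)) 2 (volume.restrict (Icc 0 τ))).toReal = √τ := by
    rw [eLpNorm_const' _ (by norm_num) (by norm_num), Measure.restrict_apply_univ,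
      Real.volume_Icc, sub_zero, Real.sqrt_eq_rpow, ENNReal.toReal_mul, ← ENNReal.toReal_rpow,
      ENNReal.toReal_ofReal hτ]
    simp
  rw [h1, ← h3]
  exact h2.trans hCS

lemma coeFn_val_sum {Ω : Set Plane} {G : ℕ → H30Space Ω} {g : ℕ → Plane → Plane}
    (hg : ∀ j, IsJetOf (H30Space.incl Ω (G j)) (g j)) (a : ℕ → ℝ) (n : ℕ) :
    H3.val (H30Space.incl Ω (∑ j ∈ Finset.range n, a j • G j)) =ᵐ[spaceMeasure Ω]
      fun x => ∑ j ∈ Finset.range n, a j • g j x := by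
  induction n with
  | zero =>
    simp only [Finset.range_zero, Finset.sum_empty, map_zero]
    exact Lp.coeFn_zero _ _ _
  | succ n ih =>
    rw [Finset.sum_range_succ, map_add, map_smul]
    have h1 := Lp.coeFn_add (H3.val (H30Space.incl Ω (∑ j ∈ Finset.range n, a j • G j)))
      (H3.val (a n • H30Space.incl Ω (G n)))
    have h2 := Lp.coeFn_smul (a n) (H3.val (H30Space.incl Ω (G n)))
    filter_upwards [ih, h1, h2, (hg n).2 MultiIdx.zero] with x e0 e1 e2 e3
    rw [Finset.sum_range_succ, ← e0]
    refine Eq.trans e1 (congrArg₂ (· + ·) rfl (Eq.trans e2 ?_))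
    exact congrArg (a n • ·) e3

/-- The Sobolev inequality for the difference of a field and a combination of test fields. -/
lemma ae_norm_val_sub_sum_le {Ω : Set Plane} (hfin : volume Ω ≠ ⊤) {G : ℕ → H30Space Ω}
    {g : ℕ → Plane → Plane} (hg : ∀ j, IsJetOf (H30Space.incl Ω (G j)) (g j)) (a : ℕ → ℝ) (n : ℕ)
    (F : H30Space Ω) : ∀ᵐ x ∂(spaceMeasure Ω),
      ‖H3.val (H30Space.incl Ω F) x - ∑ j ∈ Finset.range n, a j • g j x‖
        ≤ sobolevConst Ω * ‖F - ∑ j ∈ Finset.range n, a j • G j‖ := by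
  have h1 := ae_norm_val_le hfin (F - ∑ j ∈ Finset.range n, a j • G j).incl_mem
  rw [LinearIsometry.norm_map, map_sub] at h1
  have h2 := Lp.coeFn_sub (H3.val (H30Space.incl Ω F))
    (H3.val (H30Space.incl Ω (∑ j ∈ Finset.range n, a j • G j)))
  filter_upwards [h1, h2, coeFn_val_sum hg a n] with x e1 e2 e3
  refine le_trans (le_of_eq ?_) e1
  rw [← e3]
  exact congrArg norm e2.symm

lemma integrable_mul_Lp_top {X : Type*} [MeasurableSpace X] {μ : Measure X} (V : Lp ℝ 1 μ)
    (z : Lp ℝ ⊤ μ) : Integrable (fun x => V x * z x) μ :=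
  memLp_one_iff_integrable.1
    ((ContinuousLinearMap.mul ℝ ℝ).memLp_of_bilin 1 (Lp.memLp V) (Lp.memLp z))

set_option maxHeartbeats 1000000 in
lemma integrable_pairing {T : ℝ} {Ω : Set Plane} (v : L2L1 T Ω)
    (z : Lp (Lp ℝ ⊤ (spaceMeasure Ω)) 2 (timeMeasure T)) :
    Integrable (fun t => ∫ x in Ω, v t x * z t x) (timeMeasure T) := by
  have h := memLp_one_iff_integrable.1 ((ContinuousLinearMap.lpPairing (spaceMeasure Ω) 1 ⊤
    (ContinuousLinearMap.mul ℝ ℝ)).memLp_of_bilin 1 (Lp.memLp v) (Lp.memLp z))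
  refine h.congr (Eventually.of_forall fun t => ?_)
  exact ContinuousLinearMap.lpPairing_eq_integral (ContinuousLinearMap.mul ℝ ℝ) (v t) (z t)

lemma integrable_test_moment {T : ℝ} {Ω : Set Plane} (v : L2L1 T Ω) {ζ : Plane → ℝ}
    (hζ : Continuous ζ) (hc : HasCompactSupport ζ) :
    (∀ t, Integrable (fun x => v t x * ζ x) (spaceMeasure Ω)) ∧
      Integrable (fun t => ∫ x in Ω, v t x * ζ x) (timeMeasure T) := by
  obtain ⟨C, hC⟩ := hζ.bounded_above_of_compact_support hc
  have hm : MemLp ζ ⊤ (spaceMeasure Ω) :=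
    memLp_top_of_bound hζ.aestronglyMeasurable C (Eventually.of_forall hC)
  have he : ∀ t, (fun x => v t x * hm.toLp ζ x) =ᵐ[spaceMeasure Ω] fun x => v t x * ζ x := by
    intro t
    filter_upwards [hm.coeFn_toLp] with x hx
    rw [hx]
  refine ⟨fun t => (integrable_mul_Lp_top (v t) (hm.toLp ζ)).congr (he t), ?_⟩
  have hv : Integrable v (timeMeasure T) := (Lp.memLp v).integrable one_le_two
  let l : Lp ℝ 1 (spaceMeasure Ω) →L[ℝ] ℝ := (ContinuousLinearMap.lpPairing (spaceMeasure Ω) 1 ⊤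
    (ContinuousLinearMap.mul ℝ ℝ)).flip (hm.toLp ζ)
  have hl : ∀ t, l (v t) = ∫ x in Ω, v t x * ζ x := fun t =>
    (ContinuousLinearMap.lpPairing_eq_integral (ContinuousLinearMap.mul ℝ ℝ) (v t)
      (hm.toLp ζ)).trans (integral_congr_ae (he t))
  exact (l.integrable_comp hv).congr (Eventually.of_forall hl)

/-- The gradient amplification factor of the backward scheme is bounded in terms of the `L²` norm
of the approximated field only. -/
lemma amplification_le {V : Type*} [NormedAddCommGroup V] [NormedSpace ℝ V] {T τ C ε β : ℝ}
    (hC : 0 ≤ C) (hτ : 0 ≤ τ) (hτT : τ ≤ T) (hε0 : 0 ≤ ε) (hε1 : ε ≤ 1) (hβ : 0 ≤ β)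
    {b : ℝ → V} (hb : MemLp b 2 (volume.restrict (Icc 0 τ)))
    (hbβ : eLpNorm b 2 (volume.restrict (Icc 0 τ)) ≤ ENNReal.ofReal β)
    {n : ℕ} {θ : ℕ → ℝ → ℝ} {G : ℕ → V} (hθ : ∀ j, Continuous (θ j)) (hθ0 : ∀ j t, 0 ≤ θ j t)
    (hθs : ∀ j ∈ Finset.range n, ∀ t, t ∉ Icc 0 τ → θ j t = 0)
    (hle : ∀ t, ∑ j ∈ Finset.range n, θ j t * ‖G j‖ ≤ ‖∑ j ∈ Finset.range n, θ j t • G j‖)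
    (hap : eLpNorm (fun t => b t - ∑ j ∈ Finset.range n, θ j t • G j) 2
      (volume.restrict (Icc 0 τ)) ≤ ENNReal.ofReal ε) :
    ∏ j ∈ Finset.range n, (1 + (∫ t, θ j t) * (2 * C * ‖G j‖))
      ≤ Real.exp (2 * C * (√T * (β + 1))) := by
  refine (Real.prod_one_add_le_exp_sum _ fun j => mul_nonneg (integral_nonneg (hθ0 j))
    (by positivity)).trans (Real.exp_le_exp.2 ?_)
  have hcont : Continuous fun t => ∑ j ∈ Finset.range n, θ j t • G j :=
    continuous_finsetSum _ fun j _ => (hθ j).smul continuous_const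
  have h1 : eLpNorm (fun t => ∑ j ∈ Finset.range n, θ j t • G j) 2 (volume.restrict (Icc 0 τ))
      ≤ ENNReal.ofReal (β + 1) := by
    have e : (fun t => ∑ j ∈ Finset.range n, θ j t • G j)
        = b - fun t => b t - ∑ j ∈ Finset.range n, θ j t • G j := by
      ext t; simp
    rw [e]
    refine (eLpNorm_sub_le hb.1 (hb.1.sub hcont.aestronglyMeasurable) (by norm_num)).trans ?_
    refine (add_le_add hbβ hap).trans ?_
    rw [← ENNReal.ofReal_add hβ hε0]
    exact ENNReal.ofReal_le_ofReal (by linarith)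
  have h2 := sum_integral_mul_norm_le hτ hθ hθs hle
  calc ∑ j ∈ Finset.range n, (∫ t, θ j t) * (2 * C * ‖G j‖)
      = 2 * C * ∑ j ∈ Finset.range n, (∫ t, θ j t) * ‖G j‖ := by
        rw [Finset.mul_sum]; exact Finset.sum_congr rfl fun j _ => by ring
    _ ≤ 2 * C * (√T * (β + 1)) := by
        gcongr
        refine h2.trans ?_
        gcongr
        exact ENNReal.toReal_le_of_le_ofReal (by positivity) h1

set_option maxHeartbeats 1600000 in
/-- The duality estimate with a fixed accuracy `ε` of the approximation of the field: the weak
formulation is tested with an approximate backward solution `φ`, times the backward primitive `c`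
of the bump `ρ`. The factor in front of the bracket does not depend on `ε`. -/
lemma abs_integral_moment_le_eps {T : ℝ} (hT : 0 < T) {Ω : Set Plane} (hfin : volume Ω ≠ ⊤)
    {b : L2H3 T Ω} (hb : MemL2H30div b) {b' : Lp (H30Space Ω) 2 (timeMeasure T)}
    (hb' : ∀ᵐ t ∂(timeMeasure T), H30Space.incl Ω (b' t) = b t)
    {v : L2L1 T Ω} (hv : IsWeakSolution 0 b v) {ζ : Plane → ℝ} (hζ : IsTestFun Ω ζ) {A₀ : ℝ}
    (hA₀ : 0 ≤ A₀) (hA : ∀ x y, |fderiv ℝ ζ x y| ≤ A₀ * ‖y‖) {τ τ' : ℝ} (hτ : 0 < τ) (hττ' : τ ≤ τ')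
    (hτ'T : τ' < T) {ρ : ℝ → ℝ} (hρ : ContDiff ℝ ∞ ρ) (hρ0 : ∀ t, 0 ≤ ρ t)
    (hρs : ∀ t, t ∉ Icc τ τ' → ρ t = 0) {ε : ℝ} (hε : 0 < ε) (hε1 : ε ≤ 1) :
    |∫ t in Icc 0 T, ρ t * ∫ x in Ω, v t x * ζ x| ≤ (∫ t, ρ t) *
      ((A₀ * Real.exp (2 * sobolevConst Ω * (√T * (‖b'‖ + 1)))) *
        ((2 * sobolevConst Ω ^ 2 * ε) * (∫ t in Icc 0 T, ‖v t‖)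
          + sobolevConst Ω * (‖v‖ * ε + ∫ t in Icc τ τ', ‖v t‖ * ‖b' t‖))) := by
  have hC0 := sobolevConst_nonneg Ω
  set C := sobolevConst Ω with hC
  have hm0 : 0 ≤ ∫ t, ρ t := integral_nonneg hρ0
  set m := ∫ t, ρ t with hm
  set K := A₀ * Real.exp (2 * C * (√T * (‖b'‖ + 1))) with hK
  have hK0 : 0 ≤ K := by positivity
  have hsub : Icc 0 τ ⊆ Icc 0 T := Icc_subset_Icc_right (hττ'.trans hτ'T.le)
  have hsub' : Icc τ τ' ⊆ Icc 0 T := Icc_subset_Icc hτ.le hτ'T.le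
  have hmle : volume.restrict (Icc 0 τ) ≤ timeMeasure T := Measure.restrict_mono hsub le_rfl
  have hbm : MemLp b' 2 (volume.restrict (Icc 0 τ)) := (Lp.memLp b').mono_measure hmle
  have hvm : MemLp v 2 (volume.restrict (Icc 0 τ)) := (Lp.memLp v).mono_measure hmle
  obtain ⟨n, s, θ, G, hanti, hs0, hsn, hθsm, hθ0, hθ1, hθs, hG, hGε, hsum, hap⟩ :=
    exists_pulse_approx (P := fun G : H30Space Ω => ∃ g, IsJetOf (H30Space.incl Ω G) g)
      (fun f δ hδ => by
        obtain ⟨G, g, h1, h2⟩ := f.exists_test_near hδ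
        exact ⟨G, ⟨g, h1⟩, h2⟩) hτ hbm hε
  choose g hg using hG
  have hθr : ∀ j ∈ Finset.range n, ∀ t, t ∉ Icc 0 τ → θ j t = 0 := by
    intro j hj t ht
    refine hθs j t fun h => ht ⟨?_, ?_⟩
    · exact (hsn ▸ hanti (Nat.succ_le_of_lt (Finset.mem_range.1 hj))).trans h.1.le
    · exact h.2.le.trans (hs0 ▸ hanti (Nat.zero_le j))
  obtain ⟨φ, hφ⟩ := ApproxBackward.exists_iterate hζ (r := 2 * C ^ 2 * ε) hA₀ (by positivity) hA
    hanti hθsm hθ0 hθ1 hθs (fun j => (hg j).1) (L := fun j => 2 * C * ‖G j‖)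
    (M := fun j => C * ‖G j‖) (fun j => by positivity) (fun j => by positivity)
    (fun j x w => by
      simpa only [LinearIsometry.norm_map] using norm_fderiv_test_le hfin (hg j).1 (hg j).2 x w)
    (fun j x => by
      simpa only [LinearIsometry.norm_map] using norm_test_le hfin (hg j).1 (hg j).2 x)
    (fun j => by
      calc (∫ t, θ j t) * (2 * C * ‖G j‖) * (C * ‖G j‖)
          = 2 * C ^ 2 * ((∫ t, θ j t) * ‖G j‖ ^ 2) := by ring
        _ ≤ _ := by gcongr; exact hGε j) n
  rw [hs0] at hφ
  have hamp := amplification_le hC0 hτ.le (hττ'.trans hτ'T.le) hε.le hε1 (norm_nonneg b') hbm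
    (by
      refine (eLpNorm_mono_measure _ hmle).trans ?_
      rw [Lp.norm_def, ENNReal.ofReal_toReal (Lp.memLp b').2.ne])
    (fun j => (hθsm j).continuous) hθ0 hθr hsum hap
  set A := A₀ * ∏ j ∈ Finset.range n, (1 + (∫ t, θ j t) * (2 * C * ‖G j‖)) with hAdef
  have hA0 : 0 ≤ A := mul_nonneg hA₀ (Finset.prod_nonneg fun j _ => by
    have : 0 ≤ (∫ t, θ j t) * (2 * C * ‖G j‖) :=
      mul_nonneg (integral_nonneg (hθ0 j)) (by positivity)
    linarith)
  have hAK : A ≤ K := mul_le_mul_of_nonneg_left hamp hA₀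
  obtain ⟨c, hcsm, hcc, hcs, hcd, hcz⟩ := exists_time_cutoff hT hτ'T hρ hρ0 hρs
  have hΦ := hφ.isSpaceTimeTest hcsm hcc hcs
  set Φ : ℝ × Plane → ℝ := fun p => c p.1 * φ p with hΦdef
  obtain ⟨z, hz⟩ := exists_pairing_eq (T := T) hfin hΦ.1 hΦ.2.1 hb
  set J : ℝ → ℝ := fun t => ∫ x in Ω,
    v t x * (fderiv ℝ Φ (t, x) (1, 0) + fderiv ℝ Φ (t, x) (0, H3.val (b t) x)) with hJ
  set f : ℝ → ℝ := fun t => ∫ x in Ω, v t x * ζ x with hf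
  set bk : ℝ → H30Space Ω := fun t => ∑ j ∈ Finset.range n, θ j t • G j with hbk
  -- the weak formulation with the test function `c(t) φ(t, x)`
  have hJ0 : ∫ t in Icc 0 T, J t = 0 := by
    rw [hJ, hv Φ hΦ, neg_eq_zero]
    refine integral_eq_zero_of_ae ?_
    filter_upwards [Lp.coeFn_zero ℝ 1 (spaceMeasure Ω)] with x hx
    rw [hx]; simp
  have hzeq : ∀ᵐ t ∂(timeMeasure T), (fun x => v t x * z t x) =ᵐ[spaceMeasure Ω] fun x =>
      v t x * (fderiv ℝ Φ (t, x) (1, 0) + fderiv ℝ Φ (t, x) (0, H3.val (b t) x)) := by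
    filter_upwards [hz] with t ht
    filter_upwards [ht] with x hx
    rw [hx]
  have hJint : Integrable J (timeMeasure T) := by
    refine (integrable_pairing v z).congr ?_
    filter_upwards [hzeq] with t ht
    exact integral_congr_ae ht
  obtain ⟨hζint, hfint⟩ := integrable_test_moment v hζ.1.continuous hζ.2.1
  have hρf : Integrable (fun t => ρ t * f t) (timeMeasure T) := by
    obtain ⟨Cρ, hCρ⟩ := hρ.continuous.bounded_above_of_compact_support
      (HasCompactSupport.intro (isCompact_Icc (a := τ) (b := τ')) hρs)
    exact hfint.bdd_mul hρ.continuous.aestronglyMeasurable (Eventually.of_forall hCρ)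
  obtain ⟨hi1, hCS⟩ := integral_norm_mul_norm_le hvm
    (show MemLp (fun t => b' t - bk t) 2 (volume.restrict (Icc 0 τ)) from
      ⟨hbm.1.sub (continuous_finsetSum _ fun j _ =>
        (hθsm j).continuous.smul continuous_const).aestronglyMeasurable,
        hap.trans_lt ENNReal.ofReal_lt_top⟩)
  obtain ⟨hi2, -⟩ := integral_norm_mul_norm_le (Lp.memLp v) (Lp.memLp b')
  -- up to `τ` the field is compared with its approximation, on `[τ, τ']` with zero, and after `τ'`
  -- the cutoff `c` vanishes
  set bound : ℝ → ℝ := fun t => m * (K * ((2 * C ^ 2 * ε) * ‖v t‖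
    + C * ((Icc 0 τ).indicator (fun t => ‖v t‖ * ‖b' t - bk t‖) t
      + (Icc τ τ').indicator (fun t => ‖v t‖ * ‖b' t‖) t))) with hbound
  have hle : ∀ᵐ t ∂(timeMeasure T), ‖J t + ρ t * f t‖ ≤ bound t := by
    filter_upwards [hb', hzeq, ae_restrict_mem measurableSet_Icc] with t ht1 ht2 ht3
    obtain ⟨hcd1, hc0, hcm⟩ := hcd t ht3
    have hint := (integrable_mul_Lp_top (v t) (z t)).congr ht2
    have hw := ae_norm_val_sub_sum_le hfin hg (fun j => θ j t) n (b' t)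
    rw [ht1] at hw
    have hmain := hφ.abs_integral_le hA0 hcd1 hc0 le_rfl
      (fun h => hρs t fun h' => absurd h'.1 (not_le.2 h)) (v t) (hζint t) hint hw
    refine hmain.trans ?_
    have hi1n : 0 ≤ (Icc 0 τ).indicator (fun t => ‖v t‖ * ‖b' t - bk t‖) t :=
      indicator_nonneg (fun _ _ => by positivity) t
    have hi2n : 0 ≤ (Icc τ τ').indicator (fun t => ‖v t‖ * ‖b' t‖) t :=
      indicator_nonneg (fun _ _ => by positivity) t
    rcases le_or_gt τ' t with htτ' | htτ'
    · rw [hcz t htτ', zero_mul, hbound]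
      positivity
    · refine mul_le_mul hcm (mul_le_mul hAK ?_ (by positivity) hK0) (by positivity) hm0
      refine add_le_add le_rfl ?_
      have e : ‖v t‖ * (sobolevConst Ω * ‖b' t - bk t‖) = C * (‖v t‖ * ‖b' t - bk t‖) := by
        rw [hC]; ring
      refine e.le.trans (mul_le_mul_of_nonneg_left ?_ hC0)
      rcases le_or_gt t τ with htτ | htτ
      · rw [indicator_of_mem (show t ∈ Icc 0 τ from ⟨ht3.1, htτ⟩)]
        exact le_add_of_nonneg_right hi2n
      · have hbk0 : bk t = 0 := Finset.sum_eq_zero fun j hj => by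
          rw [hθr j hj t fun h => absurd h.2 (not_le.2 htτ), zero_smul]
        rw [hbk0, sub_zero, indicator_of_mem (show t ∈ Icc τ τ' from ⟨htτ.le, htτ'.le⟩)]
        exact le_add_of_nonneg_left hi1n
  have hvint : Integrable (fun t => ‖v t‖) (timeMeasure T) :=
    ((Lp.memLp v).integrable one_le_two).norm
  have hr1 : (timeMeasure T).restrict (Icc 0 τ) = volume.restrict (Icc 0 τ) :=
    Measure.restrict_restrict_of_subset hsub
  have hr2 : (timeMeasure T).restrict (Icc τ τ') = volume.restrict (Icc τ τ') :=
    Measure.restrict_restrict_of_subset hsub'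
  have hI1 : Integrable ((Icc 0 τ).indicator fun t => ‖v t‖ * ‖b' t - bk t‖) (timeMeasure T) := by
    rw [integrable_indicator_iff measurableSet_Icc, IntegrableOn, hr1]
    exact hi1
  have hI2 : Integrable ((Icc τ τ').indicator fun t => ‖v t‖ * ‖b' t‖) (timeMeasure T) :=
    hi2.indicator measurableSet_Icc
  have hI12 : Integrable (fun t => (Icc 0 τ).indicator (fun t => ‖v t‖ * ‖b' t - bk t‖) t
      + (Icc τ τ').indicator (fun t => ‖v t‖ * ‖b' t‖) t) (timeMeasure T) := hI1.add hI2
  have hbint : Integrable bound (timeMeasure T) :=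
    (((hvint.const_mul _).add (hI12.const_mul _)).const_mul _).const_mul _
  have hfinal : |∫ t in Icc 0 T, ρ t * f t| ≤ ∫ t in Icc 0 T, bound t := by
    have e : ∫ t in Icc 0 T, ρ t * f t = ∫ t in Icc 0 T, (J t + ρ t * f t) := by
      rw [integral_add hJint hρf, hJ0, zero_add]
    rw [e]
    exact norm_integral_le_of_norm_le hbint hle
  refine hfinal.trans ?_
  have e : ∫ t in Icc 0 T, bound t = m * (K * ((2 * C ^ 2 * ε) * (∫ t in Icc 0 T, ‖v t‖)
      + C * ((∫ t in Icc 0 τ, ‖v t‖ * ‖b' t - bk t‖) + ∫ t in Icc τ τ', ‖v t‖ * ‖b' t‖))) := by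
    rw [hbound, integral_const_mul, integral_const_mul,
      integral_add (hvint.const_mul _) (hI12.const_mul _), integral_const_mul,
      integral_const_mul, integral_add hI1 hI2, integral_indicator measurableSet_Icc,
      integral_indicator measurableSet_Icc, hr1, hr2]
  rw [e]
  gcongr
  refine hCS.trans ?_
  gcongr
  · rw [Lp.norm_def]
    exact ENNReal.toReal_mono (Lp.memLp v).2.ne (eLpNorm_mono_measure _ hmle)
  · exact ENNReal.toReal_le_of_le_ofReal hε.le hap

/-! ### Uniqueness of weak solutions -/

open scoped Convolution

/-- The moment of a weak solution with zero initial value against a test function, averaged by a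
bump in time, is controlled by the integral over the support of the bump of a fixed integrable
function. -/
lemma exists_abs_integral_moment_le {T : ℝ} (hT : 0 < T) {Ω : Set Plane} (hfin : volume Ω ≠ ⊤)
    {b : L2H3 T Ω} (hb : MemL2H30div b) {v : L2L1 T Ω} (hv : IsWeakSolution 0 b v)
    {ζ : Plane → ℝ} (hζ : IsTestFun Ω ζ) :
    ∃ N : ℝ → ℝ, Integrable N (timeMeasure T) ∧ ∀ (τ τ' : ℝ) (ρ : ℝ → ℝ), 0 < τ → τ ≤ τ' → τ' < T →
      ContDiff ℝ ∞ ρ → (∀ t, 0 ≤ ρ t) → (∀ t, t ∉ Icc τ τ' → ρ t = 0) →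
      |∫ t in Icc 0 T, ρ t * ∫ x in Ω, v t x * ζ x| ≤ (∫ t, ρ t) * ∫ t in Icc τ τ', N t := by
  obtain ⟨b', hb', -⟩ := hb.exists_lift
  obtain ⟨A₀, hA⟩ := (hζ.1.continuous_fderiv (by simp)).bounded_above_of_compact_support
    (hζ.2.1.fderiv (𝕜 := ℝ))
  have hA₀ : 0 ≤ A₀ := (norm_nonneg _).trans (hA 0)
  have hA' : ∀ x y, |fderiv ℝ ζ x y| ≤ A₀ * ‖y‖ := fun x y =>
    (fderiv ℝ ζ x).le_of_opNorm_le (hA x) y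
  set K := A₀ * Real.exp (2 * sobolevConst Ω * (√T * (‖b'‖ + 1))) with hK
  obtain ⟨hi, -⟩ := integral_norm_mul_norm_le (Lp.memLp v) (Lp.memLp b')
  refine ⟨fun t => K * sobolevConst Ω * (‖v t‖ * ‖b' t‖), hi.const_mul _, ?_⟩
  intro τ τ' ρ hτ hττ' hτ'T hρ hρ0 hρs
  rw [integral_const_mul]
  set X := ∫ t in Icc τ τ', ‖v t‖ * ‖b' t‖ with hX
  set Y := ∫ t in Icc 0 T, ‖v t‖ with hY
  have key : ∀ᶠ ε in 𝓝[>] (0 : ℝ), |∫ t in Icc 0 T, ρ t * ∫ x in Ω, v t x * ζ x|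
      ≤ (∫ t, ρ t) * (K * ((2 * sobolevConst Ω ^ 2 * ε) * Y
          + sobolevConst Ω * (‖v‖ * ε + X))) := by
    filter_upwards [Ioc_mem_nhdsGT (zero_lt_one' ℝ)] with ε hε
    exact abs_integral_moment_le_eps hT hfin hb hb' hv hζ hA₀ hA' hτ hττ' hτ'T hρ hρ0 hρs hε.1 hε.2
  have hcont : Continuous fun ε : ℝ => (∫ t, ρ t) * (K * ((2 * sobolevConst Ω ^ 2 * ε) * Y
          + sobolevConst Ω * (‖v‖ * ε + X))) := by fun_prop
  have hlim := (hcont.tendsto 0).mono_left (nhdsWithin_le_nhds (s := Ioi 0))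
  refine (ge_of_tendsto hlim key).trans (le_of_eq ?_)
  ring

/-- All moments of a weak solution with zero initial value vanish, by Lebesgue differentiation. -/
lemma ae_moment_eq_zero {T : ℝ} (hT : 0 < T) {Ω : Set Plane} (hfin : volume Ω ≠ ⊤)
    {b : L2H3 T Ω} (hb : MemL2H30div b) {v : L2L1 T Ω} (hv : IsWeakSolution 0 b v)
    {ζ : Plane → ℝ} (hζ : IsTestFun Ω ζ) :
    ∀ᵐ t ∂(timeMeasure T), ∫ x in Ω, v t x * ζ x = 0 := by
  obtain ⟨N, hN, hbd⟩ := exists_abs_integral_moment_le hT hfin hb hv hζ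
  set f : ℝ → ℝ := fun t => ∫ x in Ω, v t x * ζ x with hf
  have hfint : Integrable f (timeMeasure T) :=
    (integrable_test_moment v hζ.1.continuous hζ.2.1).2
  set F : ℝ → ℝ := (Icc 0 T).indicator f with hF
  have hFint : Integrable F := (integrable_indicator_iff measurableSet_Icc).2 hfint
  let r : ℕ → ℝ := fun i => 1 / ((i : ℝ) + 1)
  have hr0 : ∀ i, 0 < r i := fun i => by positivity
  have hrlim : Tendsto r atTop (𝓝 0) := tendsto_one_div_add_atTop_nhds_zero_nat
  let φ : ℕ → ContDiffBump (0 : ℝ) := fun i =>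
    ⟨r i / 2, r i, half_pos (hr0 i), half_lt_self (hr0 i)⟩
  have hae := ContDiffBump.ae_convolution_tendsto_right_of_locallyIntegrable (φ := φ) (K := 2)
    (μ := volume) hrlim (Eventually.of_forall fun i => by change r i ≤ 2 * (r i / 2); linarith)
    hFint.locallyIntegrable
  have hne : ∀ᵐ t ∂(timeMeasure T), t ≠ 0 ∧ t ≠ T :=
    ae_restrict_of_ae ((Measure.ae_ne volume 0).and (Measure.ae_ne volume T))
  filter_upwards [ae_restrict_of_ae hae, hne, ae_restrict_mem measurableSet_Icc] with t₀ hlim h0 hmem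
  have ht0 : 0 < t₀ := lt_of_le_of_ne hmem.1 (Ne.symm h0.1)
  have htT : t₀ < T := lt_of_le_of_ne hmem.2 h0.2
  have hFt : F t₀ = f t₀ := indicator_of_mem hmem f
  rw [hFt] at hlim
  have hsmall : ∀ᶠ i in atTop, r i < t₀ ∧ r i < T - t₀ :=
    (hrlim.eventually_lt_const ht0).and (hrlim.eventually_lt_const (sub_pos.2 htT))
  have hest : ∀ᶠ i in atTop,
      |((φ i).normed volume ⋆[ContinuousLinearMap.lsmul ℝ ℝ, volume] F) t₀|
        ≤ ∫ t in Icc (t₀ - r i) (t₀ + r i), N t ∂(timeMeasure T) := by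
    filter_upwards [hsmall] with i hi
    set ρ : ℝ → ℝ := fun t => (φ i).normed volume (t₀ - t) with hρ
    have hρs : ∀ t, t ∉ Icc (t₀ - r i) (t₀ + r i) → ρ t = 0 := by
      intro t ht
      by_contra hne
      have hsup : t₀ - t ∈ Function.support ((φ i).normed volume) := hne
      rw [ContDiffBump.support_normed_eq, Metric.mem_ball, Real.dist_eq, sub_zero, abs_lt] at hsup
      have h1 : -r i < t₀ - t := hsup.1
      have h2 : t₀ - t < r i := hsup.2
      exact ht ⟨by linarith, by linarith⟩
    have hρ1 : ∫ t, ρ t = 1 := by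
      rw [hρ, integral_sub_left_eq_self (fun t => (φ i).normed volume t) volume t₀]
      exact (φ i).integral_normed
    have hconv : ((φ i).normed volume ⋆[ContinuousLinearMap.lsmul ℝ ℝ, volume] F) t₀
        = ∫ t in Icc 0 T, ρ t * f t := by
      rw [convolution_eq_swap, ← integral_indicator measurableSet_Icc]
      congr 1
      ext t
      by_cases ht : t ∈ Icc 0 T
      · simp [hF, hρ, ht]
      · simp [hF, ht]
    have hmain := hbd (t₀ - r i) (t₀ + r i) ρ (by linarith [hi.1])
      (by linarith [hr0 i]) (by linarith [hi.2])
      ((φ i).contDiff_normed.comp (contDiff_const.sub contDiff_id))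
      (fun t => (φ i).nonneg_normed _) hρs
    rw [hρ1, one_mul] at hmain
    rw [hconv, Measure.restrict_restrict_of_subset
      (Icc_subset_Icc (by linarith [hi.1]) (by linarith [hi.2]))]
    exact hmain
  have hN0 : Tendsto (fun i => ∫ t in Icc (t₀ - r i) (t₀ + r i), N t ∂(timeMeasure T)) atTop
      (𝓝 0) := by
    refine hN.tendsto_setIntegral_nhds_zero ?_
    have h1 : Tendsto (fun i => ENNReal.ofReal (2 * r i)) atTop (𝓝 0) := by
      have := ENNReal.tendsto_ofReal (hrlim.const_mul 2)
      simpa using this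
    refine tendsto_of_tendsto_of_tendsto_of_le_of_le tendsto_const_nhds h1
      (fun _ => zero_le) fun i => ?_
    refine (Measure.restrict_apply_le _ _).trans (le_of_eq ?_)
    rw [Real.volume_Icc]; congr 1; ring
  exact tendsto_nhds_unique hlim (squeeze_zero_norm' hest hN0)

/-- An integrable function on `Ω` with vanishing moments vanishes. -/
lemma Lp_eq_zero_of_moments {Ω : Set Plane} (hΩ : IsOpen Ω) (V : Lp ℝ 1 (spaceMeasure Ω))
    (h : ∀ ζ : Plane → ℝ, IsTestFun Ω ζ → ∫ x in Ω, V x * ζ x = 0) : V = 0 := by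
  rw [Lp.eq_zero_iff_ae_eq_zero]
  have hint : IntegrableOn V Ω := L1.integrable_coeFn V
  have := hΩ.ae_eq_zero_of_integral_contDiff_smul_eq_zero hint.locallyIntegrableOn fun ζ h1 h2 h3 => by
    rw [← h ζ ⟨h1, h2, h3⟩, ← setIntegral_eq_integral_of_forall_compl_eq_zero (s := Ω)]
    · simp only [smul_eq_mul, mul_comm]
    · intro x hx
      rw [image_eq_zero_of_notMem_tsupport fun h' => hx (h3 h'), zero_smul]
  exact (ae_restrict_iff' hΩ.measurableSet).2 this

/-- On a bounded set, moments depend continuously on the test function in the topology of locally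
uniform convergence. -/
lemma continuous_moment {Ω : Set Plane} (hΩ : MeasurableSet Ω) (hbdd : Bornology.IsBounded Ω)
    (V : Lp ℝ 1 (spaceMeasure Ω)) :
    Continuous fun ζ : C(Plane, ℝ) => ∫ x in Ω, V x * ζ x := by
  rw [continuous_iff_continuousAt]
  intro ζ₀
  have hK : IsCompact (closure Ω) := hbdd.isCompact_closure
  obtain ⟨R, hR⟩ := hK.exists_bound_of_continuousOn ζ₀.continuous.continuousOn
  have hopen : ∀ᶠ ζ : C(Plane, ℝ) in 𝓝 ζ₀, MapsTo ζ (closure Ω) (Metric.ball 0 (R + 1)) :=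
    (ContinuousMap.isOpen_setOfPred_mapsTo hK Metric.isOpen_ball).mem_nhds fun x hx => by
      rw [mem_ball_zero_iff]
      exact (hR x hx).trans_lt (lt_add_one R)
  refine continuousAt_of_dominated (bound := fun x => ‖V x‖ * (R + 1))
    (Eventually.of_forall fun ζ => (Lp.aestronglyMeasurable V).mul ζ.continuous.aestronglyMeasurable)
    ?_ ((L1.integrable_coeFn V).norm.mul_const _)
    (Eventually.of_forall fun x => (continuous_const.mul (continuous_eval_const x)).continuousAt)
  filter_upwards [hopen] with ζ hζ
  filter_upwards [ae_restrict_mem hΩ] with x hx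
  rw [norm_mul]
  gcongr
  exact (mem_ball_zero_iff.1 (hζ (subset_closure hx))).le

/-- A weak solution with zero initial value vanishes: its moments against a countable dense set of
test functions vanish at almost every time. -/
lemma IsWeakSolution.eq_zero {T : ℝ} (hT : 0 < T) {Ω : Set Plane} (hΩ : IsOpen Ω)
    (hbdd : Bornology.IsBounded Ω) {b : L2H3 T Ω} (hb : MemL2H30div b) {v : L2L1 T Ω}
    (hv : IsWeakSolution 0 b v) : v = 0 := by
  have hfin : volume Ω ≠ ⊤ := hbdd.measure_lt_top.ne
  rw [Lp.eq_zero_iff_ae_eq_zero]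
  have : SecondCountableTopology {ζ : C(Plane, ℝ) // IsTestFun Ω ζ} :=
    TopologicalSpace.Subtype.secondCountableTopology _
  obtain ⟨S, hS, hSd⟩ := TopologicalSpace.exists_countable_dense {ζ : C(Plane, ℝ) // IsTestFun Ω ζ}
  have : ∀ᵐ t ∂(timeMeasure T), ∀ ζ ∈ S, ∫ x in Ω, v t x * ζ.1 x = 0 := by
    rw [ae_ball_iff hS]
    exact fun ζ _ => ae_moment_eq_zero hT hfin hb hv ζ.2
  filter_upwards [this] with t ht
  refine Lp_eq_zero_of_moments hΩ (v t) fun ζ hζ => ?_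
  have hclosed : IsClosed {ζ : {ζ : C(Plane, ℝ) // IsTestFun Ω ζ} |
      ∫ x in Ω, v t x * ζ.1 x = 0} :=
    isClosed_singleton.preimage
      ((continuous_moment hΩ.measurableSet hbdd (v t)).comp continuous_subtype_val)
  have huniv := hclosed.closure_subset_iff.2 ht
  rw [hSd.closure_eq] at huniv
  exact huniv (mem_univ ⟨⟨ζ, hζ.1.continuous⟩, hζ⟩)

lemma IsWeakSolution.sub {T : ℝ} {Ω : Set Plane} (hfin : volume Ω ≠ ⊤) {b : L2H3 T Ω}
    (hb : MemL2H30div b) {u₀ : Lp ℝ 1 (spaceMeasure Ω)} {u v : L2L1 T Ω}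
    (hu : IsWeakSolution u₀ b u) (hv : IsWeakSolution u₀ b v) : IsWeakSolution 0 b (v - u) := by
  intro φ hφ
  obtain ⟨z, hz⟩ := exists_pairing_eq (T := T) hfin hφ.1 hφ.2.1 hb
  rw [← spaceTimePairing_congr (v - u) hz, map_sub, _root_.sub_apply,
    spaceTimePairing_congr v hz, spaceTimePairing_congr u hz, hu φ hφ, hv φ hφ, sub_self,
    eq_comm, neg_eq_zero]
  refine integral_eq_zero_of_ae ?_
  filter_upwards [Lp.coeFn_zero ℝ 1 (spaceMeasure Ω)] with x hx
  rw [hx]; simp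

theorem mainTheorem3 (T : ℝ) (hT : 0 < T)
    (Ω : Set Plane) (hΩ_open : IsOpen Ω) (hΩ_bdd : Bornology.IsBounded Ω) (hΩ_conv : Convex ℝ Ω)
    (u₀ : Lp ℝ 1 (spaceMeasure Ω))
    (b : L2H3 T Ω) (bn : ℕ → L2H3 T Ω)
    (hbn_mem : ∀ n, MemL2H30div (bn n))
    (hbn_bdd : ∃ C : ℝ, ∀ n, ‖bn n‖ ≤ C)
    (hbn_weak : WeaklyConverges bn b)
    (un : ℕ → L2L1 T Ω) (u : L2L1 T Ω)
    (hun : ∀ n, IsWeakSolution u₀ (bn n) (un n))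
    (hun_lim : Tendsto un atTop (𝓝 u))
    (hu : MemL2L2 u) :
    IsSolutionOperatorValue u₀ b u := by
  have hfin : volume Ω ≠ ⊤ := hΩ_bdd.measure_lt_top.ne
  have hb : MemL2H30div b := MemL2H30div.of_weaklyConverges hbn_mem hbn_weak
  have hsol : IsWeakSolution u₀ b u :=
    IsWeakSolution.of_tendsto hfin hbn_mem hbn_bdd hbn_weak hun hun_lim hu
  exact ⟨hb, hsol, fun v hv =>
    sub_eq_zero.1 ((hsol.sub hfin hb hv).eq_zero hT hΩ_open hΩ_bdd hb)⟩
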